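/- Let $\mathbb R_+=[0,\infty)$, $\alpha>0$, $0<\beta<1$, $K>0$. Let $D\ge 0$ be strictly $\beta$-stable with $E[e^{-sD}]=\exp(-K\Gamma(1-\beta)s^\beta)$ for $s\ge 0$, and let $\omega$ be a probability measure on $\mathbb R$ with $\omega(\mathbb R_+)>0$ and $\int_0^\infty x^\alpha\,\omega(dx)<\infty$. For $\gamma>0$ and $t\ge0$ let $t^{\gamma}\omega$ denote the image of $\omega$ under $x\mapsto t^{\gamma}x$, and let $\omega^+$ be the image of $\omega$ under $x\mapsto x\vee 0$ (so $\omega^+=\omega$ if $\omega$ is concentrated on $\mathbb R_+$). **Lévy representation.** For a probability measure $\mu$ on $\mathbb R_+\times[-\infty,\infty]$ let $F(y)=\mu(\mathbb R_+\times[-\infty,y])$ and $x_0=\inf\{y:F(y)>0\}$. We say that $\mu$ has Lévy representation $[x_0,a,\eta]$ if $a\ge 0$, $\eta$ is a measure on $\mathbb R_+\times[x_0,\infty]$ with $\eta(\{(0,x_0)\})=0$, $\int\min(1,t)\,\eta(dt,dx)<\infty$ and $\eta(\mathbb R_+\times(y,\infty])<\infty$ for all $y>x_0$, and for all $s\ge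 0$ and $y\in[-\infty,\infty]$ $$\int e^{-st}1_{[-\infty,y]}(x)\,\mu(dt,dx)=\exp\Big(-as-\int\big(1-e^{-st}1_{[x_0,y]}(x)\big)\,\eta(dt,dx)\Big)$$ if $y>x_0$ (or $y=x_0$ and $F(x_0)>0$), while the left side is $0$ for all other $y$. For $C\ge 0$ and a probability measure $\omega'$ on $\mathbb R$ put $$\eta_{C,\omega'}(dt,dx)=\varepsilon_0(dt)\,C\alpha x^{-\alpha-1}1_{(0,\infty)}(x)\,dx+1_{(0,\infty)\times\mathbb R_+}(t,x)\,(t^{\beta/\alpha}\omega')(dx)\,K\beta t^{-\beta-1}dt .$$ **Theorem.** Let $(W_i,\bar J_i)_{i\ge1}$ be i.i.d. $\mathbb R_+\times\mathbb R$-valued random vectors such that $n^{-1/\beta}\sum_{i=1}^nW_i\Rightarrow D$ and $P(\bar J_i\in B\mid W_i=t)=(t^{\beta/\alpha}\omega)(B)$ for all Borel sets $B\subset\mathbb R$ and $P_{W_i}$-almost every $t$. (1) There is a random vector $(D',A)$ with $D'\overset{d}{=}D$ such that $$\Big(n^{-1/\beta}\sum_{i=1}^nW_i,\;n^{-1/\alpha}\max_{1\le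 i\le n}\bar J_i\Big)\Rightarrow(D',A),$$ and the law of $(D',A)$ has Lévy representation $[0,0,\eta_{0,\omega^+}]$. If moreover $\omega((0,\infty))>0$, then $A$ is $\alpha$-Fréchet distributed, i.e. $P(A\le y)=e^{-cy^{-\alpha}}$ for all $y>0$, for some $c>0$. (2) Let $C>0$ and let $(\tilde J_i)_{i\ge1}$ be random variables with $P(\tilde J_i\le x)=\exp(-Cx^{-\alpha})$ for $x>0$, such that $\tilde J_i$ is independent of $(W_i,\bar J_i)$ for each $i$ and the triples $(W_i,\bar J_i,\tilde J_i)$, $i\ge1$, are i.i.d. Put $J_i=\tilde J_i\vee\bar J_i$. Then there is a random vector $(D',A)$ with $D'\overset{d}{=}D$ and $A$ $\alpha$-Fréchet distributed such that $$\Big(n^{-1/\beta}\sum_{i=1}^nW_i,\;n^{-1/\alpha}\max_{1\le i\le n}J_i\Big)\Rightarrow(D',A),$$ and the law of $(D',A)$ has Lévy representation $[0,0,\eta_{C,\omega^+}]$. -/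

import Mathlib

open MeasureTheory ProbabilityTheory Filter Set
open scoped NNReal ENNReal Topology

noncomputable section

namespace SumMax

/-! ### The sum/max semigroup `ℝ₊ × [-∞, ∞]`, C-L transforms and Lévy measures -/

/-- The embedding of `ℝ₊ × ℝ` into the sum/max semigroup `ℝ₊ × [-∞, ∞]`. -/
def embed (p : ℝ≥0 × ℝ) : ℝ≥0 × EReal := (p.1, (p.2 : EReal))

/-- The semicharacter `ρ_{t,x}(s, y) = e^{-st} 1_{[-∞, y]}(x)`. -/
def semichar (s : ℝ≥0) (y : EReal) (p : ℝ≥0 × EReal) : ℝ :=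
  (Iic y).indicator (fun _ => Real.exp (-((s : ℝ) * (p.1 : ℝ)))) p.2

/-- The CDF-Laplace transform (C-L transform) of a measure on `ℝ₊ × [-∞, ∞]`. -/
def clTransform (μ : Measure (ℝ≥0 × EReal)) (s : ℝ≥0) (y : EReal) : ℝ :=
  ∫ p, semichar s y p ∂μ

/-- The distribution function of the second component. -/
def cdfSnd (μ : Measure (ℝ≥0 × EReal)) (y : EReal) : ℝ≥0∞ := μ (univ ×ˢ Iic y)

/-- The left endpoint `x₀ = inf {y : F(y) > 0}` of the second component. -/
def leftEndpoint (μ : Measure (ℝ≥0 × EReal)) : EReal := sInf {y | 0 < cdfSnd μ y}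

/-- `η` is a Lévy measure on the sum/max semigroup with left endpoint `x₀`: it lives on
`ℝ₊ × [x₀, ∞]`, gives no mass to the origin `(0, x₀)`, and satisfies
`∫ min(1, t) η(dt, [x₀, ∞]) < ∞` and `η(ℝ₊ × (y, ∞]) < ∞` for all `y > x₀`. (The last two
conditions make `η` finite on all sets bounded away from the origin, hence Radon there.) -/
structure IsLevyMeasure (x₀ : EReal) (η : Measure (ℝ≥0 × EReal)) : Prop where
  supported : η (univ ×ˢ Iio x₀) = 0
  origin : η {(0, x₀)} = 0
  small_jumps : ∫⁻ p, ((min 1 p.1 : ℝ≥0) : ℝ≥0∞) ∂η < ∞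
  tail : ∀ y, x₀ < y → η (univ ×ˢ Ioi y) < ∞

/-- `μ ∼ [x₀, a, η]`: the probability measure `μ` on `ℝ₊ × [-∞, ∞]` has left endpoint `x₀`, and
its C-L transform is `exp (-Ψ)` with
`Ψ(s, y) = a s + ∫ (1 - e^{-st} 1_{[x₀, y]}(x)) η(dt, dx)` for `y > x₀` and `Ψ(s, y) = ∞` for the
remaining `y`; if the second component has an atom at `x₀`, the formula also holds for
`y = x₀`. -/
structure HasLevyRepresentation (μ : Measure (ℝ≥0 × EReal)) (x₀ : EReal) (a : ℝ≥0)
    (η : Measure (ℝ≥0 × EReal)) : Prop where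
  left_endpoint : leftEndpoint μ = x₀
  levy : IsLevyMeasure x₀ η
  formula : ∀ (s : ℝ≥0) (y : EReal), (x₀ < y ∨ (y = x₀ ∧ 0 < cdfSnd μ x₀)) →
    Integrable (fun p => 1 - semichar s y p) η ∧
      clTransform μ s y = Real.exp (-((a : ℝ) * s + ∫ p, (1 - semichar s y p) ∂η))
  formula_zero : ∀ (s : ℝ≥0) (y : EReal), ¬ (x₀ < y ∨ (y = x₀ ∧ 0 < cdfSnd μ x₀)) →
    clTransform μ s y = 0

/-! ### The stable/Fréchet Lévy measures -/

/-- The kernel `t ↦ t^γ ω`, where `t^γ ω` is the image of `ω` under `x ↦ t^γ x`. -/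
def scaledKernel (γ : ℝ) (ω : Measure ℝ) [IsProbabilityMeasure ω] : Kernel ℝ≥0 ℝ where
  toFun t := ω.map (fun x => (t : ℝ) ^ γ * x)
  measurable' := by
    refine Measure.measurable_of_measurable_coe _ fun B hB => ?_
    have hm : Measurable (fun p : ℝ≥0 × ℝ => (p.1 : ℝ) ^ γ * p.2) := by fun_prop
    have h := measurable_measure_prodMk_left (ν := ω) (hm hB)
    convert h using 2 with t
    rw [Measure.map_apply (by fun_prop) hB]
    rfl

instance (γ : ℝ) (ω : Measure ℝ) [IsProbabilityMeasure ω] :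
    IsMarkovKernel (scaledKernel γ ω) :=
  ⟨fun t => Measure.isProbabilityMeasure_map
    (f := fun x : ℝ => (t : ℝ) ^ γ * x) (by fun_prop)⟩

/-- The measure `K β t^{-β-1} dt` on `(0, ∞)`, as a measure on `ℝ₊`. -/
def stableLevy (β K : ℝ) : Measure ℝ≥0 :=
  ((volume.restrict (Ioi (0 : ℝ))).withDensity
    (fun t => ENNReal.ofReal (K * β * t ^ (-β - 1)))).map Real.toNNReal

/-- The measure `C α x^{-α-1} dx` on `(0, ∞)`. -/
def frechetLevy (α C : ℝ) : Measure ℝ :=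
  (volume.restrict (Ioi (0 : ℝ))).withDensity
    (fun x => ENNReal.ofReal (C * α * x ^ (-α - 1)))

/-- The measure on `ℝ₊ × ℝ₊` (viewed in `ℝ₊ × [-∞, ∞]`)
`η(dt, dx) = ε₀(dt) C α x^{-α-1} dx + 1_{(0,∞) × ℝ₊}(t, x) (t^{β/α} ω)(dx) K β t^{-β-1} dt`. -/
def levyForm (α β C K : ℝ) (ω : Measure ℝ) [IsProbabilityMeasure ω] :
    Measure (ℝ≥0 × EReal) :=
  ((Measure.dirac (0 : ℝ≥0)).prod (frechetLevy α C) +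
    (stableLevy β K ⊗ₘ scaledKernel (β / α) ω).restrict (Ioi 0 ×ˢ Ici 0)).map embed

/-- The image `ω⁺` of `ω` under `x ↦ x ∨ 0`. If `ω` is concentrated on `[0, ∞)`,
then `ω⁺ = ω`. -/
def posPart (ω : Measure ℝ) : Measure ℝ := ω.map (fun x => max x 0)

instance (ω : Measure ℝ) [IsProbabilityMeasure ω] : IsProbabilityMeasure (posPart ω) :=
  Measure.isProbabilityMeasure_map (by fun_prop)

/-! ### Sums, maxima and limits -/

/-- `S(n) = W₁ + ⋯ + Wₙ` (the sequence is indexed from `0`). -/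
def partialSum {Ω : Type*} (W : ℕ → Ω → ℝ≥0) (n : ℕ) (x : Ω) : ℝ≥0 :=
  ∑ i ∈ Finset.range n, W i x

/-- `M(n) = max (J₁, …, Jₙ)` for `n ≥ 1` (the sequence is indexed from `0`). -/
def partialMax {Ω : Type*} (J : ℕ → Ω → ℝ) (n : ℕ) (x : Ω) : ℝ := ⨆ i : Fin n, J i x

/-- A sequence is i.i.d. -/
def IsIID {Ω E : Type*} [MeasurableSpace Ω] [MeasurableSpace E] (X : ℕ → Ω → E)
    (P : Measure Ω) : Prop :=
  iIndepFun X P ∧ ∀ i, IdentDistrib (X i) (X 0) P P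

/-- `W ∈ DONA_S(D)` for the i.i.d. copies `W i` of `W`: `n^{-1/β} S(n) ⇒ D`. -/
def StrictDONA {Ω Ω' : Type*} [MeasurableSpace Ω] [MeasurableSpace Ω'] (β : ℝ)
    (W : ℕ → Ω → ℝ≥0) (P : Measure Ω) [IsProbabilityMeasure P]
    (D : Ω' → ℝ≥0) (P' : Measure Ω') [IsProbabilityMeasure P'] : Prop :=
  IsIID W P ∧
    TendstoInDistribution (fun (n : ℕ) x => (n : ℝ≥0) ^ (-(1 / β)) * partialSum W n x)
      atTop D (fun _ => P) P'

/-- The normalized pair `(n^{-1/β} S(n), n^{-1/α} M(n))`. -/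
def normalizedPair {Ω : Type*} (α β : ℝ) (W : ℕ → Ω → ℝ≥0) (J : ℕ → Ω → ℝ) (n : ℕ) (x : Ω) :
    ℝ≥0 × ℝ :=
  ((n : ℝ≥0) ^ (-(1 / β)) * partialSum W n x, (n : ℝ) ^ (-(1 / α)) * partialMax J n x)

/-- The law `μ` on `ℝ₊ × ℝ` has an `α`-Fréchet distributed second component. -/
def SndIsFrechet (α : ℝ) (μ : Measure (ℝ≥0 × ℝ)) : Prop :=
  ∃ c : ℝ, 0 < c ∧ ∀ y : ℝ, 0 < y → μ.snd (Iic y) = ENNReal.ofReal (Real.exp (-(c * y ^ (-α))))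

end SumMax

end

/-!
The proof goes through CDF-Laplace transforms `E[e^{-sU} 1{V ≤ y}]` of random pairs `(U, V)`.

Since the pairs `(W i, J i)` are i.i.d., the transform of the normalized pair is the `n`-th power of
a single expectation, so its limit is `exp (-Ψ(s, y))` as soon as `n` times the deficit
`1 - E[e^{-s b W} 1{a J ≤ y}]`, with `b = n^{-1/β}` and `a = n^{-1/α}`, tends to `Ψ(s, y)`.
Conditionally on `W = t` the variable `Jbar` is distributed as `t^{β/α} X` with `X ∼ ω`, and the
choice of the two norming sequences makes this relation scale invariant. The deficit is therefore
`∫∫ (1 - e^{-su} 1{u^{β/α} x ≤ y}) ν_n(du) ω(dx)` with `ν_n = n · law (n^{-1/β} W)`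
(`nat_mul_integral_semichar_sub_one`).

* For fixed `x` the inner integral converges to the one against the Lévy measure `K β t^{-β-1} dt`.
  The limit law of the sums gives convergence of the Laplace exponents `∫ (1 - e^{-su}) ν_n(du)`
  (`LaplaceAttracted.laplaceTendsto`). In the variable `v = e^{-u}` these exponents determine the
  integrals of all polynomials against `(1 - v) ν_n`, so Weierstrass approximation extends the
  convergence to continuous functions (`LaplaceTendsto.tendsto_continuous`), and squeezing by ramps
  extends it to the indicators of half-lines (`LaplaceTendsto.tendsto_indicator_Ioi`).
* The bound `ν_n (r, ∞) ≤ c r^{-β}`, uniform in `n` (`LaplaceAttracted.exists_tail_bound`), dominates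
  the inner integrals by a constant plus a multiple of `max x 0 ^ α`, which is `ω`-integrable.

The continuity theorem for the transforms (`exists_tendsto_of_tendsto_semichar`), a combination of
tightness with the uniqueness of Laplace transforms, then produces the limit law. Negative levels
carry no mass in the limit, because `ω [0, ∞) > 0` and the `n`-th powers decay to `0`. The Lévy
representation is read off from the explicit value of `∫ (1 - e^{-st} 1{x ≤ y}) η(dt, dx)`
(`lintegral_one_sub_semichar_levyForm`, `hasLevyRepresentation_of_formula`). An independent Fréchet
variable inside the maximum multiplies the single expectation by `exp (-C y^{-α} / n)`, hence adds
`C y^{-α}` to the exponent (`integral_semichar_max_eq`).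
-/

namespace SumMax

/-! ### Convergence of Laplace exponents and vague convergence on `(0, ∞)` -/

theorem tendsto_of_forall_eps_squeeze {a : ℕ → ℝ} {L : ℝ}
    (h : ∀ ε > 0, ∃ b c : ℕ → ℝ, ∃ B C : ℝ, Tendsto b atTop (𝓝 B) ∧ Tendsto c atTop (𝓝 C) ∧
      (∀ n, b n ≤ a n) ∧ (∀ n, a n ≤ c n) ∧ L - ε ≤ B ∧ C ≤ L + ε) :
    Tendsto a atTop (𝓝 L) := by
  rw [tendsto_order]
  constructor
  · intro l hl
    obtain ⟨b, -, B, -, hb, -, hba, -, hB, -⟩ := h ((L - l) / 2) (by linarith)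
    filter_upwards [hb.eventually (lt_mem_nhds (show l < B by linarith))] with n hn
    exact hn.trans_le (hba n)
  · intro l hl
    obtain ⟨-, c, -, C, -, hc, -, hca, -, hC⟩ := h ((l - L) / 2) (by linarith)
    filter_upwards [hc.eventually (gt_mem_nhds (show C < l by linarith))] with n hn
    exact (hca n).trans_lt hn

theorem one_sub_exp_neg_nonneg (u : ℝ≥0) : 0 ≤ 1 - Real.exp (-(u : ℝ)) := by
  have : Real.exp (-(u : ℝ)) ≤ 1 := Real.exp_le_one_iff.2 (by simp)
  linarith

theorem exp_neg_mul_le_one {s : ℝ} (hs : 0 ≤ s) (u : ℝ≥0) : Real.exp (-(s * u)) ≤ 1 :=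
  Real.exp_le_one_iff.2 (by have := mul_nonneg hs u.2; simpa using this)

/-- Bernoulli's inequality for `v = e^{-u}`. -/
theorem one_sub_exp_neg_mul_le (s : ℝ) (u : ℝ≥0) :
    1 - Real.exp (-(s * u)) ≤ max 1 s * (1 - Real.exp (-(u : ℝ))) := by
  set p := max 1 s
  have h1 : Real.exp (-(p * u)) ≤ Real.exp (-(s * u)) := by
    have : s * u ≤ p * u := mul_le_mul_of_nonneg_right (le_max_right _ _) u.2
    exact Real.exp_le_exp.2 (by linarith)
  have h2 := one_add_mul_self_le_rpow_one_add (s := Real.exp (-(u : ℝ)) - 1) (p := p)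
    (by have := Real.exp_pos (-(u : ℝ)); linarith) (le_max_left _ _)
  rw [add_sub_cancel, ← Real.exp_mul] at h2
  have h3 : -(u : ℝ) * p = -(p * u) := by ring
  rw [h3] at h2
  linarith

/-- The Laplace exponents `s ↦ ∫ (1 - e^{-su}) dm_n` of the measures `m n` on `[0, ∞)` converge
pointwise to the one of `ν`. -/
structure LaplaceTendsto (m : ℕ → Measure ℝ≥0) (ν : Measure ℝ≥0) : Prop where
  integrable : ∀ n, Integrable (fun u : ℝ≥0 => 1 - Real.exp (-(u : ℝ))) (m n)
  integrable_limit : Integrable (fun u : ℝ≥0 => 1 - Real.exp (-(u : ℝ))) ν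
  tendsto : ∀ s : ℝ, 0 ≤ s → Tendsto (fun n => ∫ u, (1 - Real.exp (-(s * (u : ℝ)))) ∂(m n)) atTop
    (𝓝 (∫ u, (1 - Real.exp (-(s * (u : ℝ)))) ∂ν))

theorem integrable_of_abs_le_mul_one_sub_exp {μ : Measure ℝ≥0}
    (hμ : Integrable (fun u : ℝ≥0 => 1 - Real.exp (-(u : ℝ))) μ) {f : ℝ≥0 → ℝ}
    (hf : Measurable f) (C : ℝ) (h : ∀ u : ℝ≥0, |f u| ≤ C * (1 - Real.exp (-(u : ℝ)))) :
    Integrable f μ :=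
  (hμ.const_mul C).mono' hf.aestronglyMeasurable (ae_of_all _ h)

theorem integrable_one_sub_exp_neg_mul {μ : Measure ℝ≥0}
    (hμ : Integrable (fun u : ℝ≥0 => 1 - Real.exp (-(u : ℝ))) μ) {s : ℝ} (hs : 0 ≤ s) :
    Integrable (fun u : ℝ≥0 => 1 - Real.exp (-(s * (u : ℝ)))) μ := by
  refine integrable_of_abs_le_mul_one_sub_exp hμ (by fun_prop) (max 1 s) fun u => ?_
  rw [abs_of_nonneg (by linarith [exp_neg_mul_le_one hs u])]
  exact one_sub_exp_neg_mul_le s u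

theorem integrable_one_sub_exp_mul_comp {μ : Measure ℝ≥0}
    (hμ : Integrable (fun u : ℝ≥0 => 1 - Real.exp (-(u : ℝ))) μ) {h : ℝ → ℝ}
    (hh : Continuous h) :
    Integrable (fun u : ℝ≥0 => (1 - Real.exp (-(u : ℝ))) * h (Real.exp (-(u : ℝ)))) μ := by
  obtain ⟨C, hC⟩ := isCompact_Icc.exists_bound_of_continuousOn (s := Icc (0 : ℝ) 1)
    hh.continuousOn
  refine integrable_of_abs_le_mul_one_sub_exp hμ (by fun_prop) C fun u => ?_
  rw [abs_mul, abs_of_nonneg (one_sub_exp_neg_nonneg u), mul_comm]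
  refine mul_le_mul_of_nonneg_right (hC _ ⟨(Real.exp_pos _).le, ?_⟩) (one_sub_exp_neg_nonneg u)
  exact Real.exp_le_one_iff.2 (by simp)

namespace LaplaceTendsto

variable {m : ℕ → Measure ℝ≥0} {ν : Measure ℝ≥0}

theorem tendsto_polynomial (H : LaplaceTendsto m ν) (p : Polynomial ℝ) :
    Tendsto (fun n => ∫ u : ℝ≥0, (1 - Real.exp (-(u : ℝ))) * p.eval (Real.exp (-(u : ℝ))) ∂(m n))
      atTop (𝓝 (∫ u : ℝ≥0, (1 - Real.exp (-(u : ℝ))) * p.eval (Real.exp (-(u : ℝ))) ∂ν)) := by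
  induction p using Polynomial.induction_on' with
  | add p q hp hq =>
    simp only [Polynomial.eval_add, mul_add]
    rw [integral_add (integrable_one_sub_exp_mul_comp H.integrable_limit p.continuous)
      (integrable_one_sub_exp_mul_comp H.integrable_limit q.continuous)]
    refine (hp.add hq).congr fun n => ?_
    rw [integral_add (integrable_one_sub_exp_mul_comp (H.integrable n) p.continuous)
      (integrable_one_sub_exp_mul_comp (H.integrable n) q.continuous)]
  | monomial k c =>
    -- `(1 - v) v^k = (1 - v^{k+1}) - (1 - v^k)` for `v = e^{-u}`
    have key : ∀ u : ℝ≥0, (1 - Real.exp (-(u : ℝ))) *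
        (Polynomial.monomial k c).eval (Real.exp (-(u : ℝ))) =
        c * ((1 - Real.exp (-(((k + 1 : ℕ) : ℝ) * (u : ℝ)))) -
          (1 - Real.exp (-((k : ℝ) * (u : ℝ))))) := by
      intro u
      rw [Polynomial.eval_monomial, ← mul_neg, ← mul_neg, Real.exp_nat_mul, Real.exp_nat_mul]
      ring
    have hint : ∀ μ : Measure ℝ≥0, Integrable (fun u : ℝ≥0 => 1 - Real.exp (-(u : ℝ))) μ →
        ∫ u : ℝ≥0, (1 - Real.exp (-(u : ℝ))) *
          (Polynomial.monomial k c).eval (Real.exp (-(u : ℝ))) ∂μ =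
        c * (∫ u : ℝ≥0, (1 - Real.exp (-(((k + 1 : ℕ) : ℝ) * (u : ℝ)))) ∂μ -
          ∫ u : ℝ≥0, (1 - Real.exp (-((k : ℝ) * (u : ℝ)))) ∂μ) := by
      intro μ hμ
      simp only [key]
      rw [integral_const_mul, integral_sub
        (integrable_one_sub_exp_neg_mul hμ (Nat.cast_nonneg _))
        (integrable_one_sub_exp_neg_mul hμ (Nat.cast_nonneg _))]
    rw [hint ν H.integrable_limit]
    simp only [hint _ (H.integrable _)]
    exact ((H.tendsto _ (Nat.cast_nonneg _)).sub (H.tendsto _ (Nat.cast_nonneg _))).const_mul c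

/-- In the variable `v = e^{-u} ∈ [0, 1]` the measures `(1 - e^{-u}) m_n(du)` have convergent
moments, so they converge weakly by the Weierstrass approximation theorem. -/
theorem tendsto_continuous (H : LaplaceTendsto m ν) {h : ℝ → ℝ} (hh : Continuous h) :
    Tendsto (fun n => ∫ u : ℝ≥0, (1 - Real.exp (-(u : ℝ))) * h (Real.exp (-(u : ℝ))) ∂(m n))
      atTop (𝓝 (∫ u : ℝ≥0, (1 - Real.exp (-(u : ℝ))) * h (Real.exp (-(u : ℝ))) ∂ν)) := by
  refine tendsto_of_forall_eps_squeeze fun ε hε => ?_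
  set A := ∫ u : ℝ≥0, (1 - Real.exp (-(u : ℝ))) ∂ν
  have hA : 0 ≤ A := integral_nonneg one_sub_exp_neg_nonneg
  obtain ⟨δ, hδ, hδA⟩ : ∃ δ : ℝ, 0 < δ ∧ 2 * δ * A ≤ ε := by
    refine ⟨ε / (2 * (A + 1)), by positivity, ?_⟩
    rw [mul_div_assoc', div_mul_eq_mul_div, div_le_iff₀ (by positivity)]
    nlinarith
  obtain ⟨p, hp⟩ := exists_polynomial_near_of_continuousOn 0 1 h hh.continuousOn δ hδ
  have hv : ∀ u : ℝ≥0, |p.eval (Real.exp (-(u : ℝ))) - h (Real.exp (-(u : ℝ)))| < δ := fun u =>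
    hp _ ⟨(Real.exp_pos _).le, Real.exp_le_one_iff.2 (by simp)⟩
  have key : ∀ q : Polynomial ℝ, (∀ u : ℝ≥0, h (Real.exp (-(u : ℝ))) ≤
      q.eval (Real.exp (-(u : ℝ)))) → ∀ μ : Measure ℝ≥0,
      Integrable (fun u : ℝ≥0 => 1 - Real.exp (-(u : ℝ))) μ →
      ∫ u : ℝ≥0, (1 - Real.exp (-(u : ℝ))) * h (Real.exp (-(u : ℝ))) ∂μ ≤
      ∫ u : ℝ≥0, (1 - Real.exp (-(u : ℝ))) * q.eval (Real.exp (-(u : ℝ))) ∂μ := fun q hq μ hμ =>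
    integral_mono (integrable_one_sub_exp_mul_comp hμ hh)
      (integrable_one_sub_exp_mul_comp hμ q.continuous)
      fun u => mul_le_mul_of_nonneg_left (hq u) (one_sub_exp_neg_nonneg u)
  have key' : ∀ q : Polynomial ℝ, (∀ u : ℝ≥0, q.eval (Real.exp (-(u : ℝ))) ≤
      h (Real.exp (-(u : ℝ)))) → ∀ μ : Measure ℝ≥0,
      Integrable (fun u : ℝ≥0 => 1 - Real.exp (-(u : ℝ))) μ →
      ∫ u : ℝ≥0, (1 - Real.exp (-(u : ℝ))) * q.eval (Real.exp (-(u : ℝ))) ∂μ ≤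
      ∫ u : ℝ≥0, (1 - Real.exp (-(u : ℝ))) * h (Real.exp (-(u : ℝ))) ∂μ := fun q hq μ hμ =>
    integral_mono (integrable_one_sub_exp_mul_comp hμ q.continuous)
      (integrable_one_sub_exp_mul_comp hμ hh)
      fun u => mul_le_mul_of_nonneg_left (hq u) (one_sub_exp_neg_nonneg u)
  have hsplit : ∀ d : ℝ, ∫ u : ℝ≥0, (1 - Real.exp (-(u : ℝ))) *
      (h (Real.exp (-(u : ℝ))) + d) ∂ν =
      ∫ u : ℝ≥0, (1 - Real.exp (-(u : ℝ))) * h (Real.exp (-(u : ℝ))) ∂ν + d * A := by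
    intro d
    simp only [mul_add]
    rw [integral_add (integrable_one_sub_exp_mul_comp H.integrable_limit hh)
      (H.integrable_limit.mul_const d), integral_mul_const, mul_comm d]
  refine ⟨_, _, _, _, H.tendsto_polynomial (p - Polynomial.C δ),
    H.tendsto_polynomial (p + Polynomial.C δ), fun n => key' _ (fun u => ?_) _ (H.integrable n),
    fun n => key _ (fun u => ?_) _ (H.integrable n), ?_, ?_⟩
  · have := abs_lt.1 (hv u); simp only [Polynomial.eval_sub, Polynomial.eval_C]; linarith
  · have := abs_lt.1 (hv u); simp only [Polynomial.eval_add, Polynomial.eval_C]; linarith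
  · have h1 := hsplit (-(2 * δ))
    have h2 : ∫ u : ℝ≥0, (1 - Real.exp (-(u : ℝ))) * (h (Real.exp (-(u : ℝ))) + -(2 * δ)) ∂ν ≤
        ∫ u : ℝ≥0, (1 - Real.exp (-(u : ℝ))) *
          (p - Polynomial.C δ).eval (Real.exp (-(u : ℝ))) ∂ν := by
      refine integral_mono
        (integrable_one_sub_exp_mul_comp H.integrable_limit (hh.add continuous_const))
        (integrable_one_sub_exp_mul_comp H.integrable_limit (p - Polynomial.C δ).continuous)
        fun u => mul_le_mul_of_nonneg_left ?_ (one_sub_exp_neg_nonneg u)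
      have := abs_lt.1 (hv u); simp only [Polynomial.eval_sub, Polynomial.eval_C]; linarith
    linarith
  · have h1 := hsplit (2 * δ)
    have h2 : ∫ u : ℝ≥0, (1 - Real.exp (-(u : ℝ))) *
          (p + Polynomial.C δ).eval (Real.exp (-(u : ℝ))) ∂ν ≤
        ∫ u : ℝ≥0, (1 - Real.exp (-(u : ℝ))) * (h (Real.exp (-(u : ℝ))) + 2 * δ) ∂ν := by
      refine integral_mono
        (integrable_one_sub_exp_mul_comp H.integrable_limit (p + Polynomial.C δ).continuous)
        (integrable_one_sub_exp_mul_comp H.integrable_limit (hh.add continuous_const))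
        fun u => mul_le_mul_of_nonneg_left ?_ (one_sub_exp_neg_nonneg u)
      have := abs_lt.1 (hv u); simp only [Polynomial.eval_add, Polynomial.eval_C]; linarith
    linarith

end LaplaceTendsto

/-- The continuous function equal to `1` on `(-∞, c - δ]`, to `0` on `[c, ∞)`, and affine in
between. -/
noncomputable def ramp (c δ v : ℝ) : ℝ := max 0 (min 1 ((c - v) / δ))

theorem continuous_ramp (c δ : ℝ) : Continuous (ramp c δ) := by
  unfold ramp; fun_prop

theorem ramp_nonneg (c δ v : ℝ) : 0 ≤ ramp c δ v := le_max_left _ _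

theorem ramp_le_one (c δ v : ℝ) : ramp c δ v ≤ 1 := max_le zero_le_one (min_le_left _ _)

theorem ramp_eq_zero {c δ v : ℝ} (hδ : 0 < δ) (h : c ≤ v) : ramp c δ v = 0 :=
  max_eq_left ((min_le_right _ _).trans (div_nonpos_of_nonpos_of_nonneg (by linarith) hδ.le))

theorem ramp_eq_one {c δ v : ℝ} (hδ : 0 < δ) (h : v ≤ c - δ) : ramp c δ v = 1 := by
  have : 1 ≤ (c - v) / δ := by rw [le_div_iff₀ hδ]; linarith
  rw [ramp, min_eq_left this]; simp

theorem tendsto_const_div_nat_add_one (a : ℝ) :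
    Tendsto (fun k : ℕ => a / ((k : ℝ) + 1)) atTop (𝓝 0) := by
  simpa [div_eq_mul_inv] using (tendsto_one_div_add_atTop_nhds_zero_nat (𝕜 := ℝ)).const_mul a

namespace LaplaceTendsto

variable {m : ℕ → Measure ℝ≥0} {ν : Measure ℝ≥0}

theorem tendsto_ramp (H : LaplaceTendsto m ν) {s c δ : ℝ} (hs : 0 ≤ s) (hδ : 0 < δ)
    (hc : c < 1) :
    Tendsto (fun n => ∫ u : ℝ≥0, Real.exp (-(s * u)) * ramp c δ (Real.exp (-(u : ℝ))) ∂(m n))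
      atTop (𝓝 (∫ u : ℝ≥0, Real.exp (-(s * u)) * ramp c δ (Real.exp (-(u : ℝ))) ∂ν)) := by
  have hcont : Continuous fun v : ℝ => v ^ s * ramp c δ v / max (1 - v) (1 - c) := by
    refine ((Real.continuous_rpow_const hs).mul (continuous_ramp c δ)).div (by fun_prop) fun v => ?_
    have := le_max_right (1 - v) (1 - c)
    linarith
  have key : ∀ u : ℝ≥0, (1 - Real.exp (-(u : ℝ))) * (Real.exp (-(u : ℝ)) ^ s *
      ramp c δ (Real.exp (-(u : ℝ))) / max (1 - Real.exp (-(u : ℝ))) (1 - c)) =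
      Real.exp (-(s * u)) * ramp c δ (Real.exp (-(u : ℝ))) := by
    intro u
    rcases le_or_gt c (Real.exp (-(u : ℝ))) with h | h
    · simp [ramp_eq_zero hδ h]
    · rw [max_eq_left (by linarith), ← Real.exp_mul,
        show -(u : ℝ) * s = -(s * u) by ring, mul_div_cancel₀]
      linarith
  simpa only [key] using H.tendsto_continuous hcont

theorem tendsto_indicator_Ioi (H : LaplaceTendsto m ν) {s : ℝ} (hs : 0 ≤ s) {z : ℝ≥0}
    (hz : 0 < z) (hν : ν {z} = 0) :
    Tendsto (fun n => ∫ u : ℝ≥0, (Ioi z).indicator (fun u : ℝ≥0 => Real.exp (-(s * u))) u ∂(m n))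
      atTop (𝓝 (∫ u : ℝ≥0, (Ioi z).indicator (fun u : ℝ≥0 => Real.exp (-(s * u))) u ∂ν)) := by
  set c := Real.exp (-(z : ℝ)) with hcdef
  have hc1 : c < 1 := Real.exp_lt_one_iff.2 (by simpa using hz)
  have hmem : ∀ u : ℝ≥0, u ∈ Ioi z ↔ Real.exp (-(u : ℝ)) < c := fun u => by
    rw [hcdef, Real.exp_lt_exp, neg_lt_neg_iff, NNReal.coe_lt_coe, mem_Ioi]
  set δ : ℕ → ℝ := fun k => (1 - c) / 2 / ((k : ℝ) + 1)
  have hδ : ∀ k, 0 < δ k := fun k => by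
    have : 0 < (1 - c) / 2 := by linarith
    positivity
  have hδle : ∀ k, δ k ≤ (1 - c) / 2 := fun k => by
    refine div_le_self (by linarith) ?_
    have : (0 : ℝ) ≤ k := Nat.cast_nonneg k
    linarith
  have hδ0 : Tendsto δ atTop (𝓝 0) := tendsto_const_div_nat_add_one _
  have hE : ∀ u : ℝ≥0, Real.exp (-(s * u)) ≤ 1 := exp_neg_mul_le_one hs
  -- all functions below vanish for `v ≥ (1 + c) / 2` and are bounded by `1`
  have hbound : ∀ (u : ℝ≥0) (r : ℝ), 0 ≤ r → r ≤ 1 →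
      ((1 + c) / 2 ≤ Real.exp (-(u : ℝ)) → r = 0) →
      |Real.exp (-(s * u)) * r| ≤ 2 / (1 - c) * (1 - Real.exp (-(u : ℝ))) := by
    intro u r h0 h1 h
    rw [abs_of_nonneg (by positivity)]
    have h2 : 0 < 1 - c := by linarith
    rcases le_or_gt ((1 + c) / 2) (Real.exp (-(u : ℝ))) with h' | h'
    · rw [h h']
      have := one_sub_exp_neg_nonneg u
      simp; positivity
    · calc _ ≤ 1 * 1 := mul_le_mul (hE u) h1 h0 zero_le_one
        _ ≤ _ := by rw [div_mul_eq_mul_div, le_div_iff₀ h2]; linarith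
  have hind : ∀ u : ℝ≥0, (Ioi z).indicator (fun u : ℝ≥0 => Real.exp (-(s * u))) u =
      Real.exp (-(s * u)) * (Ioi z).indicator 1 u := fun u => by
    by_cases h : u ∈ Ioi z <;> simp [h]
  simp only [hind]
  have hb1 : ∀ k (u : ℝ≥0), |Real.exp (-(s * u)) * ramp c (δ k) (Real.exp (-(u : ℝ)))| ≤
      2 / (1 - c) * (1 - Real.exp (-(u : ℝ))) := fun k u =>
    hbound u _ (ramp_nonneg _ _ _) (ramp_le_one _ _ _) fun h =>
      ramp_eq_zero (hδ k) (by linarith)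
  have hb2 : ∀ k (u : ℝ≥0),
      |Real.exp (-(s * u)) * ramp (c + δ k) (δ k) (Real.exp (-(u : ℝ)))| ≤
      2 / (1 - c) * (1 - Real.exp (-(u : ℝ))) := fun k u =>
    hbound u _ (ramp_nonneg _ _ _) (ramp_le_one _ _ _) fun h =>
      ramp_eq_zero (hδ k) (by linarith [hδle k])
  have hb3 : ∀ (u : ℝ≥0), |Real.exp (-(s * u)) * (Ioi z).indicator 1 u| ≤
      2 / (1 - c) * (1 - Real.exp (-(u : ℝ))) := fun u =>
    hbound u _ (indicator_nonneg (by simp) _) (indicator_le_self' (by simp) u) fun h =>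
      indicator_of_notMem (by rw [hmem]; linarith) _
  have hm1 : ∀ c δ : ℝ, Measurable fun u : ℝ≥0 =>
      Real.exp (-(s * u)) * ramp c δ (Real.exp (-(u : ℝ))) := fun c δ => by
    have := (continuous_ramp c δ).measurable
    fun_prop
  have hm3 : Measurable fun u : ℝ≥0 => Real.exp (-(s * u)) * (Ioi z).indicator 1 u :=
    Measurable.mul (by fun_prop) (measurable_one.indicator measurableSet_Ioi)
  have hI : ∀ (μ : Measure ℝ≥0), Integrable (fun u : ℝ≥0 => 1 - Real.exp (-(u : ℝ))) μ → ∀ k,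
      ∫ u : ℝ≥0, Real.exp (-(s * u)) * ramp c (δ k) (Real.exp (-(u : ℝ))) ∂μ ≤
        ∫ u : ℝ≥0, Real.exp (-(s * u)) * (Ioi z).indicator 1 u ∂μ ∧
      ∫ u : ℝ≥0, Real.exp (-(s * u)) * (Ioi z).indicator 1 u ∂μ ≤
        ∫ u : ℝ≥0, Real.exp (-(s * u)) * ramp (c + δ k) (δ k) (Real.exp (-(u : ℝ))) ∂μ := by
    intro μ hμ k
    have i1 := integrable_of_abs_le_mul_one_sub_exp hμ (hm1 _ _) _ (hb1 k)
    have i2 := integrable_of_abs_le_mul_one_sub_exp hμ (hm1 _ _) _ (hb2 k)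
    have i3 := integrable_of_abs_le_mul_one_sub_exp hμ hm3 _ hb3
    refine ⟨integral_mono i1 i3 fun u => mul_le_mul_of_nonneg_left ?_ (Real.exp_pos _).le,
      integral_mono i3 i2 fun u => mul_le_mul_of_nonneg_left ?_ (Real.exp_pos _).le⟩
    · by_cases h : u ∈ Ioi z
      · simp [h, ramp_le_one]
      · simp only [h, not_false_eq_true, indicator_of_notMem]
        rw [hmem, not_lt] at h
        rw [ramp_eq_zero (hδ k) h]
    · by_cases h : u ∈ Ioi z
      · rw [ramp_eq_one (hδ k) (by rw [hmem] at h; linarith)]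
        simp [h]
      · simp [h, ramp_nonneg]
  have hl1 : Tendsto (fun k => ∫ u : ℝ≥0, Real.exp (-(s * u)) *
      ramp c (δ k) (Real.exp (-(u : ℝ))) ∂ν) atTop
      (𝓝 (∫ u : ℝ≥0, Real.exp (-(s * u)) * (Ioi z).indicator 1 u ∂ν)) := by
    refine tendsto_integral_of_dominated_convergence _ (fun k => (hm1 _ _).aestronglyMeasurable)
      (H.integrable_limit.const_mul (2 / (1 - c))) (fun k => ae_of_all _ (hb1 k))
      (ae_of_all _ fun u => ?_)
    refine tendsto_const_nhds.mul (tendsto_nhds_of_eventually_eq ?_)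
    by_cases h : u ∈ Ioi z
    · have h' := (hmem u).1 h
      filter_upwards [hδ0.eventually (gt_mem_nhds (sub_pos.2 h'))] with k hk
      rw [ramp_eq_one (hδ k) (by linarith)]
      simp [h]
    · refine Eventually.of_forall fun k => ?_
      simp only [h, not_false_eq_true, indicator_of_notMem]
      rw [hmem, not_lt] at h
      rw [ramp_eq_zero (hδ k) h]
  have hl2 : Tendsto (fun k => ∫ u : ℝ≥0, Real.exp (-(s * u)) *
      ramp (c + δ k) (δ k) (Real.exp (-(u : ℝ))) ∂ν) atTop
      (𝓝 (∫ u : ℝ≥0, Real.exp (-(s * u)) * (Ioi z).indicator 1 u ∂ν)) := by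
    refine tendsto_integral_of_dominated_convergence _ (fun k => (hm1 _ _).aestronglyMeasurable)
      (H.integrable_limit.const_mul (2 / (1 - c))) (fun k => ae_of_all _ (hb2 k)) ?_
    have hne : ∀ᵐ u ∂ν, u ≠ z := by rw [ae_iff]; simpa using hν
    filter_upwards [hne] with u hu
    refine tendsto_const_nhds.mul (tendsto_nhds_of_eventually_eq ?_)
    by_cases h : u ∈ Ioi z
    · refine Eventually.of_forall fun k => ?_
      rw [ramp_eq_one (hδ k) (by rw [hmem] at h; linarith)]
      simp [h]
    · have h' : c < Real.exp (-(u : ℝ)) := by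
        rw [hcdef, Real.exp_lt_exp, neg_lt_neg_iff, NNReal.coe_lt_coe]
        exact lt_of_le_of_ne (not_lt.1 h) hu
      filter_upwards [hδ0.eventually (gt_mem_nhds (sub_pos.2 h'))] with k hk
      rw [ramp_eq_zero (hδ k) (by linarith)]
      simp [h]
  refine tendsto_of_forall_eps_squeeze fun ε hε => ?_
  obtain ⟨k, hk1, hk2⟩ := ((hl1.eventually (lt_mem_nhds (sub_lt_self _ hε))).and
    (hl2.eventually (gt_mem_nhds (lt_add_of_pos_right _ hε)))).exists
  exact ⟨_, _, _, _, H.tendsto_ramp hs (hδ k) hc1,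
    H.tendsto_ramp hs (hδ k) (show c + δ k < 1 by linarith [hδle k]),
    fun n => (hI _ (H.integrable n) k).1, fun n => (hI _ (H.integrable n) k).2, hk1.le, hk2.le⟩

end LaplaceTendsto

theorem integrable_exp_indicator_Ioi {μ : Measure ℝ≥0}
    (hμ : Integrable (fun u : ℝ≥0 => 1 - Real.exp (-(u : ℝ))) μ) {s : ℝ} (hs : 0 ≤ s) {z : ℝ≥0}
    (hz : 0 < z) :
    Integrable (fun u => (Ioi z).indicator (fun u : ℝ≥0 => Real.exp (-(s * u))) u) μ := by
  refine integrable_of_abs_le_mul_one_sub_exp hμ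
    (Measurable.indicator (by fun_prop) measurableSet_Ioi) (1 - Real.exp (-(z : ℝ)))⁻¹ fun u => ?_
  have h1 : 0 < 1 - Real.exp (-(z : ℝ)) := sub_pos.2 (Real.exp_lt_one_iff.2 (by simpa using hz))
  by_cases h : u ∈ Ioi z
  · have h2 : Real.exp (-(u : ℝ)) ≤ Real.exp (-(z : ℝ)) :=
      Real.exp_le_exp.2 (neg_le_neg (NNReal.coe_le_coe.2 (le_of_lt h)))
    rw [indicator_of_mem h, abs_of_pos (Real.exp_pos _)]
    refine (exp_neg_mul_le_one hs u).trans ?_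
    rw [inv_mul_eq_div, le_div_iff₀ h1]; linarith
  · have := one_sub_exp_neg_nonneg u
    simp only [h, not_false_eq_true, indicator_of_notMem, abs_zero]
    positivity

/-! ### The kernel `1 - e^{-su} 1{u^γ x ≤ y}` -/

/-- The function `1 - e^{-su} 1{u^γ x ≤ y}`. -/
noncomputable def deficit (γ s y x : ℝ) (u : ℝ≥0) : ℝ :=
  1 - {u : ℝ≥0 | (u : ℝ) ^ γ * x ≤ y}.indicator (fun u : ℝ≥0 => Real.exp (-(s * u))) u

theorem deficit_nonneg {γ s y x : ℝ} (hs : 0 ≤ s) (u : ℝ≥0) : 0 ≤ deficit γ s y x u := by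
  rw [deficit, sub_nonneg]
  exact indicator_le_self' (fun _ _ => (Real.exp_pos _).le) u |>.trans (exp_neg_mul_le_one hs u)

theorem deficit_le_one {γ s y x : ℝ} (u : ℝ≥0) : deficit γ s y x u ≤ 1 := by
  rw [deficit, sub_le_self_iff]
  exact indicator_nonneg (fun _ _ => (Real.exp_pos _).le) u

theorem measurable_deficit (γ s y : ℝ) :
    Measurable fun p : ℝ≥0 × ℝ => deficit γ s y p.2 p.1 := by
  refine measurable_const.sub ?_
  have hS : MeasurableSet {p : ℝ≥0 × ℝ | (p.1 : ℝ) ^ γ * p.2 ≤ y} :=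
    measurableSet_le (by fun_prop) measurable_const
  have : Measurable fun p : ℝ≥0 × ℝ => Real.exp (-(s * p.1)) := by fun_prop
  exact this.indicator hS

theorem deficit_of_nonpos {γ s y x : ℝ} (hy : 0 ≤ y) (hx : x ≤ 0) (u : ℝ≥0) :
    deficit γ s y x u = 1 - Real.exp (-(s * u)) := by
  rw [deficit, indicator_of_mem]
  exact (mul_nonpos_of_nonneg_of_nonpos (Real.rpow_nonneg u.2 _) hx).trans hy

/-- The threshold `(y / x)^{1/γ}` beyond which `u^γ x > y`. -/
noncomputable def threshold (γ y x : ℝ) : ℝ≥0 := (y / x).toNNReal ^ γ⁻¹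

theorem threshold_pos {γ y x : ℝ} (hy : 0 < y) (hx : 0 < x) : 0 < threshold γ y x :=
  NNReal.rpow_pos (Real.toNNReal_pos.2 (div_pos hy hx))

theorem rpow_mul_le_iff {γ y x : ℝ} (hγ : 0 < γ) (hy : 0 < y) (hx : 0 < x) (u : ℝ≥0) :
    (u : ℝ) ^ γ * x ≤ y ↔ u ≤ threshold γ y x := by
  rw [threshold, NNReal.le_rpow_inv_iff hγ, ← le_div_iff₀ hx, ← NNReal.coe_rpow,
    Real.le_toNNReal_iff_coe_le (div_pos hy hx).le]

theorem deficit_of_pos {γ s y x : ℝ} (hγ : 0 < γ) (hy : 0 < y) (hx : 0 < x) (u : ℝ≥0) :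
    deficit γ s y x u = 1 - Real.exp (-(s * u)) +
      (Ioi (threshold γ y x)).indicator (fun u : ℝ≥0 => Real.exp (-(s * u))) u := by
  rw [deficit]
  by_cases h : u ≤ threshold γ y x
  · rw [indicator_of_mem (by exact (rpow_mul_le_iff hγ hy hx u).2 h),
      indicator_of_notMem (by simpa using h)]; ring
  · rw [indicator_of_notMem (by simpa [rpow_mul_le_iff hγ hy hx] using h),
      indicator_of_mem (by simpa using h)]; ring

theorem integrable_deficit {μ : Measure ℝ≥0}
    (hμ : Integrable (fun u : ℝ≥0 => 1 - Real.exp (-(u : ℝ))) μ) {γ s y : ℝ} (x : ℝ)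
    (hγ : 0 < γ) (hs : 0 ≤ s) (hy : 0 < y) : Integrable (deficit γ s y x) μ := by
  rcases le_or_gt x 0 with hx | hx
  · rw [funext (deficit_of_nonpos hy.le hx)]
    exact integrable_one_sub_exp_neg_mul hμ hs
  · rw [funext (deficit_of_pos hγ hy hx)]
    exact (integrable_one_sub_exp_neg_mul hμ hs).add
      (integrable_exp_indicator_Ioi hμ hs (threshold_pos hy hx))

theorem LaplaceTendsto.tendsto_deficit {m : ℕ → Measure ℝ≥0} {ν : Measure ℝ≥0}
    (H : LaplaceTendsto m ν) [NullSingletonClass ν] {γ s y : ℝ} (x : ℝ) (hγ : 0 < γ) (hs : 0 ≤ s)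
    (hy : 0 < y) :
    Tendsto (fun n => ∫ u, deficit γ s y x u ∂(m n)) atTop (𝓝 (∫ u, deficit γ s y x u ∂ν)) := by
  rcases le_or_gt x 0 with hx | hx
  · simp only [deficit_of_nonpos hy.le hx]
    exact H.tendsto s hs
  · have hz := threshold_pos (γ := γ) hy hx
    simp only [deficit_of_pos hγ hy hx]
    rw [integral_add (integrable_one_sub_exp_neg_mul H.integrable_limit hs)
      (integrable_exp_indicator_Ioi H.integrable_limit hs hz)]
    refine ((H.tendsto s hs).add (H.tendsto_indicator_Ioi hs hz (measure_singleton _))).congr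
      fun n => ?_
    rw [integral_add (integrable_one_sub_exp_neg_mul (H.integrable n) hs)
      (integrable_exp_indicator_Ioi (H.integrable n) hs hz)]

/-! ### The power-law measures -/

theorem frechetLevy_Ioi {α C : ℝ} (hα : 0 < α) (hC : 0 ≤ C) {z : ℝ} (hz : 0 < z) :
    frechetLevy α C (Ioi z) = ENNReal.ofReal (C * z ^ (-α)) := by
  have hlt : -α - 1 < -1 := by linarith
  rw [frechetLevy, withDensity_apply _ measurableSet_Ioi, Measure.restrict_restrict
    measurableSet_Ioi, Set.inter_eq_left.2 (Ioi_subset_Ioi hz.le),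
    ← ofReal_integral_eq_lintegral_ofReal ((integrableOn_Ioi_rpow_of_lt hlt hz).const_mul _)]
  · rw [integral_const_mul, integral_Ioi_rpow_of_lt hlt hz, sub_add_cancel]
    congr 1
    field_simp
  · filter_upwards [ae_restrict_mem measurableSet_Ioi] with t ht
    have : 0 < t := hz.trans ht
    positivity

theorem frechetLevy_Iic_zero (α C : ℝ) : frechetLevy α C (Iic 0) = 0 := by
  rw [frechetLevy, withDensity_apply _ measurableSet_Iic, Measure.restrict_restrict
    measurableSet_Iic]
  have : Iic (0 : ℝ) ∩ Ioi 0 = ∅ := by ext; simp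
  simp [this]

instance (α C : ℝ) : SFinite (frechetLevy α C) := by
  unfold frechetLevy; infer_instance

instance (α C : ℝ) : NullSingletonClass (frechetLevy α C) := by
  unfold frechetLevy; infer_instance

theorem stableLevy_eq_map (β K : ℝ) :
    stableLevy β K = (frechetLevy β K).map Real.toNNReal := rfl

instance (β K : ℝ) : SFinite (stableLevy β K) := by
  rw [stableLevy_eq_map]; infer_instance

theorem stableLevy_Ioi {β K : ℝ} (hβ : 0 < β) (hK : 0 ≤ K) {z : ℝ≥0} (hz : 0 < z) :
    stableLevy β K (Ioi z) = ENNReal.ofReal (K * (z : ℝ) ^ (-β)) := by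
  rw [stableLevy_eq_map, Measure.map_apply (by fun_prop) measurableSet_Ioi,
    ← frechetLevy_Ioi hβ hK (NNReal.coe_pos.2 hz)]
  congr 1
  ext t
  simp [Real.lt_toNNReal_iff_coe_lt]

theorem stableLevy_zero (β K : ℝ) : stableLevy β K {0} = 0 := by
  rw [stableLevy_eq_map, Measure.map_apply (by fun_prop) (measurableSet_singleton _)]
  refine measure_mono_null (fun t ht => ?_) (frechetLevy_Iic_zero β K)
  simpa using ht

instance (β K : ℝ) : NullSingletonClass (stableLevy β K) := by
  refine ⟨fun z => ?_⟩
  rcases eq_or_ne z 0 with rfl | hz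
  · exact stableLevy_zero β K
  · rw [stableLevy_eq_map, Measure.map_apply (by fun_prop) (measurableSet_singleton _)]
    refine measure_mono_null (fun t ht => ?_) (measure_singleton (μ := frechetLevy β K) (z : ℝ))
    have ht' : t.toNNReal = z := ht
    have h0 : 0 < t := Real.toNNReal_pos.1 (ht' ▸ pos_iff_ne_zero.2 hz)
    rw [mem_singleton_iff, ← ht', Real.coe_toNNReal t h0.le]

/-- The Laplace exponent of the stable Lévy measure: `1 - e^{-su} = ∫₀ᵘ s e^{-st} dt`, so by the
layer cake formula it is `∫₀^∞ K t^{-β} s e^{-st} dt`, a Gamma integral. -/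
theorem lintegral_one_sub_exp_stableLevy {β K : ℝ} (hβ : 0 < β) (hβ1 : β < 1) (hK : 0 < K)
    {s : ℝ} (hs : 0 ≤ s) :
    ∫⁻ u : ℝ≥0, ENNReal.ofReal (1 - Real.exp (-(s * u))) ∂(stableLevy β K) =
      ENNReal.ofReal (K * Real.Gamma (1 - β) * s ^ β) := by
  rcases hs.eq_or_lt with rfl | hs
  · simp [Real.zero_rpow hβ.ne']
  have hprim : ∀ u : ℝ, ∫ t in (0 : ℝ)..u, s * Real.exp (-(s * t)) = 1 - Real.exp (-(s * u)) := by
    intro u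
    rw [intervalIntegral.integral_eq_sub_of_hasDerivAt (f := fun t => -Real.exp (-(s * t)))]
    · simp; ring
    · intro t _
      have h1 : HasDerivAt (fun t : ℝ => -(s * t)) (-(s * 1)) t :=
        ((hasDerivAt_id t).const_mul s).neg
      exact h1.exp.neg.congr_deriv (by ring)
    · exact (by fun_prop : Continuous fun t => s * Real.exp (-(s * t))).intervalIntegrable _ _
  have hlc := lintegral_comp_eq_lintegral_meas_lt_mul (stableLevy β K)
    (f := fun u : ℝ≥0 => (u : ℝ)) (g := fun t => s * Real.exp (-(s * t)))
    (ae_of_all _ fun u => u.2) (by fun_prop)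
    (fun t _ => (by fun_prop : Continuous fun t => s * Real.exp (-(s * t))).intervalIntegrable _ _)
    (ae_of_all _ fun t => by positivity)
  simp only [hprim] at hlc
  rw [hlc]
  have hG := Real.integral_rpow_mul_exp_neg_mul_Ioi (a := 1 - β) (r := s) (by linarith) hs
  have hGpos : 0 < Real.Gamma (1 - β) := Real.Gamma_pos_of_pos (by linarith)
  have hne : (1 / s) ^ (1 - β) * Real.Gamma (1 - β) ≠ 0 := by positivity
  have hint : IntegrableOn (fun t : ℝ => t ^ (1 - β - 1) * Real.exp (-(s * t))) (Ioi 0) := by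
    by_contra h
    rw [integral_undef h] at hG
    exact hne hG.symm
  have hcongr : ∫⁻ t in Ioi (0 : ℝ), stableLevy β K {a : ℝ≥0 | t < a} *
        ENNReal.ofReal (s * Real.exp (-(s * t))) =
      ∫⁻ t in Ioi (0 : ℝ), ENNReal.ofReal
        (K * s * (t ^ (1 - β - 1) * Real.exp (-(s * t)))) := by
    refine setLIntegral_congr_fun measurableSet_Ioi fun t ht => ?_
    have ht : 0 < t := ht
    have hset : {a : ℝ≥0 | t < a} = Ioi t.toNNReal := by
      ext a; simp [Real.toNNReal_lt_iff_lt_coe ht.le]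
    simp only [hset]
    rw [stableLevy_Ioi hβ hK.le (Real.toNNReal_pos.2 ht), Real.coe_toNNReal t ht.le,
      ← ENNReal.ofReal_mul (by positivity), show 1 - β - 1 = -β by ring]
    congr 1; ring
  rw [hcongr, ← ofReal_integral_eq_lintegral_ofReal (hint.const_mul _), integral_const_mul, hG]
  · congr 1
    rw [one_div, Real.inv_rpow hs.le, ← Real.rpow_neg hs.le]
    have : s ^ β = s * s ^ (-(1 - β)) := by
      rw [← Real.rpow_one_add' hs.le (by linarith)]; congr 1; ring
    rw [this]; ring
  · filter_upwards [ae_restrict_mem measurableSet_Ioi] with t ht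
    have : 0 < t := ht
    positivity

theorem integrable_one_sub_exp_stableLevy {β K : ℝ} (hβ : 0 < β) (hβ1 : β < 1) (hK : 0 < K) :
    Integrable (fun u : ℝ≥0 => 1 - Real.exp (-(u : ℝ))) (stableLevy β K) := by
  have h := lintegral_one_sub_exp_stableLevy hβ hβ1 hK zero_le_one
  simp only [one_mul] at h
  refine ⟨by fun_prop, ?_⟩
  rw [hasFiniteIntegral_iff_ofReal (ae_of_all _ one_sub_exp_neg_nonneg), h]
  exact ENNReal.ofReal_lt_top

theorem integral_one_sub_exp_stableLevy {β K : ℝ} (hβ : 0 < β) (hβ1 : β < 1) (hK : 0 < K)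
    {s : ℝ} (hs : 0 ≤ s) :
    ∫ u : ℝ≥0, (1 - Real.exp (-(s * u))) ∂(stableLevy β K) =
      K * Real.Gamma (1 - β) * s ^ β := by
  have hGpos : 0 < Real.Gamma (1 - β) := Real.Gamma_pos_of_pos (by linarith)
  rw [integral_eq_lintegral_of_nonneg_ae
    (ae_of_all _ fun u => by have := exp_neg_mul_le_one hs u; simp [this]) (by fun_prop),
    lintegral_one_sub_exp_stableLevy hβ hβ1 hK hs, ENNReal.toReal_ofReal (by positivity)]

theorem threshold_rpow_neg {α β y x : ℝ} (hα : 0 < α) (hβ : 0 < β) (hy : 0 < y) (hx : 0 < x) :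
    (threshold (β / α) y x : ℝ) ^ (-β) = y ^ (-α) * x ^ α := by
  rw [threshold, NNReal.coe_rpow, Real.coe_toNNReal _ (div_pos hy hx).le,
    ← Real.rpow_mul (div_pos hy hx).le,
    show (β / α)⁻¹ * -β = -α by field_simp, Real.div_rpow hy.le hx.le,
    Real.rpow_neg hx.le, div_inv_eq_mul]

/-! ### Regular variation in the domain of attraction of a stable law -/

/-- If `φ_n^n → e^{-c}` then `n (1 - φ_n) → c`, because `1 - φ ≤ -log φ ≤ (1 - φ) / φ`. -/
theorem tendsto_nat_mul_one_sub_of_tendsto_pow {φ : ℕ → ℝ} {c : ℝ} (hpos : ∀ n, 0 < φ n)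
    (h : Tendsto (fun n => φ n ^ n) atTop (𝓝 (Real.exp (-c)))) :
    Tendsto (fun n : ℕ => (n : ℝ) * (1 - φ n)) atTop (𝓝 c) := by
  have h1 : Tendsto (fun n : ℕ => -((n : ℝ) * Real.log (φ n))) atTop (𝓝 c) := by
    have := ((Real.continuousAt_log (Real.exp_pos (-c)).ne').tendsto.comp h).neg
    simpa [Function.comp_def, Real.log_pow] using this
  have h2 : Tendsto φ atTop (𝓝 1) := by
    have h3 : Tendsto (fun n : ℕ => (n : ℝ)⁻¹ * (n * Real.log (φ n))) atTop (𝓝 (0 * (-c))) := by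
      refine tendsto_inv_atTop_nhds_zero_nat.mul ?_
      simpa using h1.neg
    rw [zero_mul] at h3
    have h4 := (Real.continuous_exp.tendsto 0).comp h3
    rw [Real.exp_zero] at h4
    refine h4.congr' ?_
    filter_upwards [eventually_gt_atTop 0] with n hn
    have : (n : ℝ) ≠ 0 := by positivity
    simp [inv_mul_cancel_left₀ this, Real.exp_log (hpos n)]
  have h5 : Tendsto (fun n : ℕ => φ n * -((n : ℝ) * Real.log (φ n))) atTop (𝓝 c) := by
    simpa using h2.mul h1
  refine tendsto_of_tendsto_of_tendsto_of_le_of_le h5 h1 (fun n => ?_) (fun n => ?_)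
  · have h6 : -Real.log (φ n) ≤ (φ n)⁻¹ - 1 := by
      rw [← Real.log_inv]; exact Real.log_le_sub_one_of_pos (inv_pos.2 (hpos n))
    have h7 : φ n * -Real.log (φ n) ≤ 1 - φ n := by
      refine (mul_le_mul_of_nonneg_left h6 (hpos n).le).trans_eq ?_
      rw [mul_sub, mul_inv_cancel₀ (hpos n).ne', mul_one]
    have := mul_le_mul_of_nonneg_left h7 (Nat.cast_nonneg (α := ℝ) n)
    simp only
    linarith
  · have h6 := Real.log_le_sub_one_of_pos (hpos n)
    have := mul_le_mul_of_nonneg_left h6 (Nat.cast_nonneg (α := ℝ) n)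
    simp only
    linarith

/-- The measure `n P(n^{-1/β} W ∈ ·)` for a variable `W` with law `Q`. -/
noncomputable def rescaled (β : ℝ) (Q : Measure ℝ≥0) (n : ℕ) : Measure ℝ≥0 :=
  (n : ℝ≥0∞) • Q.map (fun t => (n : ℝ≥0) ^ (-(1 / β)) * t)

instance (β : ℝ) (Q : Measure ℝ≥0) [IsProbabilityMeasure Q] (n : ℕ) :
    IsFiniteMeasure (rescaled β Q n) := by
  unfold rescaled
  exact Measure.smul_finite _ (ENNReal.natCast_ne_top n)

theorem integral_rescaled (β : ℝ) (Q : Measure ℝ≥0) (n : ℕ) {f : ℝ≥0 → ℝ} (hf : Measurable f) :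
    ∫ u, f u ∂(rescaled β Q n) = n * ∫ t, f ((n : ℝ≥0) ^ (-(1 / β)) * t) ∂Q := by
  rw [rescaled, integral_smul_measure,
    integral_map (by fun_prop) hf.aestronglyMeasurable]
  simp

theorem integrable_exp_neg_mul {Q : Measure ℝ≥0} [IsFiniteMeasure Q] {s : ℝ}
    (hs : 0 ≤ s) : Integrable (fun t : ℝ≥0 => Real.exp (-(s * t))) Q :=
  Integrable.of_bound (by fun_prop) 1 (ae_of_all _ fun u => by
    rw [Real.norm_eq_abs, abs_of_pos (Real.exp_pos _)]; exact exp_neg_mul_le_one hs u)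

/-- The law `Q` is in the domain of attraction of the strictly stable law with Laplace exponent
`K Γ(1 - β) s^β`, for the norming constants `n^{1/β}`, in terms of Laplace transforms. -/
def LaplaceAttracted (β K : ℝ) (Q : Measure ℝ≥0) : Prop :=
  ∀ s : ℝ, 0 ≤ s → Tendsto
    (fun n : ℕ => (∫ t : ℝ≥0, Real.exp (-(s * ((n : ℝ≥0) ^ (-(1 / β)) * t : ℝ≥0))) ∂Q) ^ n) atTop
    (𝓝 (Real.exp (-(K * Real.Gamma (1 - β) * s ^ β))))

namespace LaplaceAttracted

variable {β K : ℝ} {Q : Measure ℝ≥0} [IsProbabilityMeasure Q]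

theorem laplaceTendsto (h : LaplaceAttracted β K Q) (hβ : 0 < β) (hβ1 : β < 1) (hK : 0 < K) :
    LaplaceTendsto (rescaled β Q) (stableLevy β K) where
  integrable n := Integrable.of_bound (by fun_prop) 1 (ae_of_all _ fun u => by
    rw [Real.norm_eq_abs, abs_of_nonneg (one_sub_exp_neg_nonneg u)]
    linarith [Real.exp_pos (-(u : ℝ))])
  integrable_limit := integrable_one_sub_exp_stableLevy hβ hβ1 hK
  tendsto s hs := by
    rw [integral_one_sub_exp_stableLevy hβ hβ1 hK hs]
    have hint : ∀ n : ℕ, Integrable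
        (fun t : ℝ≥0 => Real.exp (-(s * ((n : ℝ≥0) ^ (-(1 / β)) * t : ℝ≥0)))) Q := fun n => by
      have := integrable_exp_neg_mul (Q := Q) (s := s * ((n : ℝ≥0) ^ (-(1 / β)) : ℝ≥0))
        (by positivity)
      simpa only [NNReal.coe_mul, mul_assoc] using this
    refine (tendsto_nat_mul_one_sub_of_tendsto_pow (fun n => ?_) (h s hs)).congr fun n => ?_
    · exact integral_exp_pos (hint n)
    · rw [integral_rescaled β Q n (by fun_prop), integral_sub (integrable_const _) (hint n)]
      simp

/-- The uniform tail bound `n P(n^{-1/β} W > z) ≤ C z^{-β}`. -/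
theorem exists_tail_bound (h : LaplaceAttracted β K Q) (hβ : 0 < β) (hβ1 : β < 1) (hK : 0 < K) :
    ∃ C : ℝ, 0 ≤ C ∧ ∀ (n : ℕ) (z : ℝ≥0), 0 < z →
      (rescaled β Q n).real (Ioi z) ≤ C * (z : ℝ) ^ (-β) := by
  obtain ⟨C₀, hC₀⟩ := ((h.laplaceTendsto hβ hβ1 hK).tendsto 1 zero_le_one).bddAbove_range
  have hC₀' : ∀ n : ℕ, (n : ℝ) * 
      ∫ t : ℝ≥0, (1 - Real.exp (-(((n : ℝ≥0) ^ (-(1 / β)) * t : ℝ≥0) : ℝ))) ∂Q ≤ C₀ := fun n => by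
    have := hC₀ (mem_range_self n)
    rw [integral_rescaled β Q n (by fun_prop)] at this
    simpa only [one_mul] using this
  have hint : ∀ s : ℝ≥0, Integrable (fun t : ℝ≥0 => 1 - Real.exp (-((s * t : ℝ≥0) : ℝ))) Q :=
    fun s => (integrable_const _).sub (by
      simpa only [NNReal.coe_mul] using integrable_exp_neg_mul (Q := Q) s.coe_nonneg)
  set ψ : ℝ≥0 → ℝ := fun s => ∫ t : ℝ≥0, (1 - Real.exp (-((s * t : ℝ≥0) : ℝ))) ∂Q with hψ
  have hψ_mono : Monotone ψ := fun s s' hss => integral_mono (hint s) (hint s') fun t => by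
    have : s * t ≤ s' * t := mul_le_mul_left hss t
    have : Real.exp (-((s' * t : ℝ≥0) : ℝ)) ≤ Real.exp (-((s * t : ℝ≥0) : ℝ)) :=
      Real.exp_le_exp.2 (neg_le_neg (NNReal.coe_le_coe.2 this))
    simp only
    linarith
  have hψ_one : ∀ s, ψ s ≤ 1 := fun s => by
    refine (integral_mono (hint s) (integrable_const 1) fun t => ?_).trans_eq (by simp)
    have := Real.exp_pos (-((s * t : ℝ≥0) : ℝ))
    simp only
    linarith
  have hC₀_nonneg : 0 ≤ C₀ := by simpa using hC₀' 0
  -- comparison of `1 / a` with `n^{-1/β}` for `n = ⌊a^β⌋`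
  have hψ_le : ∀ a : ℝ≥0, 0 < a → ψ a⁻¹ ≤ max 1 (2 * C₀) * (a : ℝ) ^ (-β) := by
    intro a ha
    have ha' : (0 : ℝ) < a := ha
    have hp : 0 < (a : ℝ) ^ β := by positivity
    rw [Real.rpow_neg ha'.le, ← div_eq_mul_inv, le_div_iff₀ hp]
    rcases lt_or_ge ((a : ℝ) ^ β) 1 with h1 | h1
    · calc ψ a⁻¹ * (a : ℝ) ^ β ≤ 1 * 1 := mul_le_mul (hψ_one _) h1.le hp.le zero_le_one
        _ ≤ _ := by simp
    · set n := ⌊(a : ℝ) ^ β⌋₊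
      have hn1 : 1 ≤ n := Nat.le_floor (by simpa using h1)
      have hn1' : (1 : ℝ) ≤ n := by exact_mod_cast hn1
      have hnle : (n : ℝ) ≤ (a : ℝ) ^ β := Nat.floor_le hp.le
      have hlt : (a : ℝ) ^ β < n + 1 := Nat.lt_floor_add_one _
      have hinv : a⁻¹ ≤ (n : ℝ≥0) ^ (-(1 / β)) := by
        rw [NNReal.rpow_neg]
        refine inv_anti₀ (NNReal.rpow_pos (by positivity)) ?_
        rw [one_div, NNReal.rpow_inv_le_iff hβ]
        exact_mod_cast hnle
      have h2 := (mul_le_mul_of_nonneg_left (hψ_mono hinv) (Nat.cast_nonneg n)).trans (hC₀' n)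
      have h3 : 0 ≤ ψ a⁻¹ := integral_nonneg fun t => one_sub_exp_neg_nonneg _
      calc ψ a⁻¹ * (a : ℝ) ^ β ≤ ψ a⁻¹ * (2 * n) :=
            mul_le_mul_of_nonneg_left (by linarith) h3
        _ ≤ 2 * C₀ := by linarith
        _ ≤ _ := le_max_right _ _
  have he : 0 < 1 - Real.exp (-1) := sub_pos.2 (Real.exp_lt_one_iff.2 (by norm_num))
  -- Markov's inequality
  have htail : ∀ a : ℝ≥0, 0 < a → Q.real (Ioi a) ≤
      (1 - Real.exp (-1))⁻¹ * max 1 (2 * C₀) * (a : ℝ) ^ (-β) := by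
    intro a ha
    have h1 : (1 - Real.exp (-1)) * Q.real (Ioi a) ≤ ψ a⁻¹ := by
      refine (mul_le_mul_of_nonneg_left (measureReal_mono ?_) he.le).trans
        (mul_meas_ge_le_integral_of_nonneg (ae_of_all _ fun t => one_sub_exp_neg_nonneg _)
          (hint a⁻¹) (1 - Real.exp (-1)))
      intro t (ht : a < t)
      have h2 : (1 : ℝ) ≤ (a⁻¹ * t : ℝ≥0) := by
        have : 1 ≤ a⁻¹ * t := by
          rw [inv_mul_eq_div, one_le_div₀ ha]; exact ht.le
        exact_mod_cast this
      have := Real.exp_le_exp.2 (neg_le_neg h2)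
      simp only [mem_ofPred_eq]
      linarith
    rw [mul_assoc, inv_mul_eq_div, le_div_iff₀ he, mul_comm]
    exact h1.trans (hψ_le a ha)
  refine ⟨(1 - Real.exp (-1))⁻¹ * max 1 (2 * C₀), by positivity, fun n z hz => ?_⟩
  rcases Nat.eq_zero_or_pos n with rfl | hn
  · simp only [rescaled, Nat.cast_zero, zero_smul, measureReal_zero, Pi.zero_apply]
    positivity
  · have hn' : (0 : ℝ≥0) < n := by exact_mod_cast hn
    have hb : 0 < (n : ℝ≥0) ^ (1 / β) := NNReal.rpow_pos hn'
    have hpre : (fun t => (n : ℝ≥0) ^ (-(1 / β)) * t) ⁻¹' Ioi z =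
        Ioi ((n : ℝ≥0) ^ (1 / β) * z) := by
      ext t
      simp only [mem_preimage, mem_Ioi]
      rw [NNReal.rpow_neg, inv_mul_eq_div, lt_div_iff₀ hb, mul_comm]
    have h1 : (rescaled β Q n).real (Ioi z) = n * Q.real (Ioi ((n : ℝ≥0) ^ (1 / β) * z)) := by
      rw [rescaled, measureReal_ennreal_smul_apply,
        map_measureReal_apply (by fun_prop) measurableSet_Ioi, hpre]
      simp
    have h2 : ((((n : ℝ≥0) ^ (1 / β) * z : ℝ≥0) : ℝ)) ^ (-β) = (n : ℝ)⁻¹ * (z : ℝ) ^ (-β) := by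
      rw [NNReal.coe_mul, Real.mul_rpow (by positivity) (by positivity), NNReal.coe_rpow,
        ← Real.rpow_mul (by positivity), NNReal.coe_natCast,
        show 1 / β * -β = -1 by field_simp, Real.rpow_neg_one]
    have hn'' : (n : ℝ) ≠ 0 := by positivity
    have h3 := mul_le_mul_of_nonneg_left (htail _ (mul_pos hb hz)) (Nat.cast_nonneg (α := ℝ) n)
    rw [h2] at h3
    rw [h1]
    refine h3.trans_eq ?_
    field_simp

end LaplaceAttracted

/-! ### The limiting Lévy exponent -/

/-- The double integral `∫∫ (1 - e^{-su} 1{u^{β/α} x ≤ y}) K β u^{-β-1} du ω(dx)`. -/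
noncomputable def jumpExponent (α β K : ℝ) (ω : Measure ℝ) (s y : ℝ) : ℝ :=
  ∫ x, ∫ u, deficit (β / α) s y x u ∂(stableLevy β K) ∂ω

theorem max_zero_rpow_eq_indicator {α : ℝ} (hα : 0 < α) :
    (fun x : ℝ => max x 0 ^ α) = (Ici 0).indicator fun x => x ^ α := by
  ext x
  rcases le_or_gt 0 x with h | h
  · rw [max_eq_left h, indicator_of_mem (by exact h)]
  · rw [max_eq_right h.le, indicator_of_notMem (by simpa using h), Real.zero_rpow hα.ne']

theorem integrable_max_zero_rpow {α : ℝ} (hα : 0 < α) {ω : Measure ℝ}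
    (h : IntegrableOn (fun x : ℝ => x ^ α) (Ici 0) ω) :
    Integrable (fun x : ℝ => max x 0 ^ α) ω := by
  rw [max_zero_rpow_eq_indicator hα]
  exact h.integrable_indicator measurableSet_Ici

theorem stronglyMeasurable_integral_deficit (γ s y : ℝ) (μ : Measure ℝ≥0) [SFinite μ] :
    StronglyMeasurable fun x => ∫ u, deficit γ s y x u ∂μ :=
  ((measurable_deficit γ s y).comp measurable_swap).stronglyMeasurable.integral_prod_right

/-- If the Laplace exponent at `s` is at most `M` and the tails are dominated by `C z^{-β}`, then
the integrated deficit is dominated by an affine function of `(x⁺)^α`. -/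
theorem abs_integral_deficit_le {α β : ℝ} (hα : 0 < α) (hβ : 0 < β) {μ : Measure ℝ≥0}
    (hμ : Integrable (fun u : ℝ≥0 => 1 - Real.exp (-(u : ℝ))) μ) {s y M C : ℝ} (hs : 0 ≤ s)
    (hy : 0 < y) (hM : ∫ u : ℝ≥0, (1 - Real.exp (-(s * u))) ∂μ ≤ M)
    (hC : ∀ z : ℝ≥0, 0 < z → μ.real (Ioi z) ≤ C * (z : ℝ) ^ (-β)) (x : ℝ) :
    |∫ u, deficit (β / α) s y x u ∂μ| ≤ M + C * y ^ (-α) * max x 0 ^ α := by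
  rw [abs_of_nonneg (integral_nonneg fun u => deficit_nonneg hs u)]
  rcases le_or_gt x 0 with hx | hx
  · simp only [deficit_of_nonpos hy.le hx]
    rw [max_eq_right hx, Real.zero_rpow hα.ne']
    simpa using hM
  · have hz := threshold_pos (γ := β / α) hy hx
    simp only [deficit_of_pos (div_pos hβ hα) hy hx]
    have hfin : μ (Ioi (threshold (β / α) y x)) ≠ ∞ := by
      have h0 := integrable_exp_indicator_Ioi hμ le_rfl hz
      have h1 : (fun u => (Ioi (threshold (β / α) y x)).indicator
          (fun u : ℝ≥0 => Real.exp (-(0 * u))) u) =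
          (Ioi (threshold (β / α) y x)).indicator fun _ => (1 : ℝ) := by
        simp
      rw [h1, integrable_indicator_iff measurableSet_Ioi, integrableOn_const_iff] at h0
      simpa [lt_top_iff_ne_top] using h0
    rw [integral_add (integrable_one_sub_exp_neg_mul hμ hs)
      (integrable_exp_indicator_Ioi hμ hs hz), max_eq_left hx.le]
    refine add_le_add hM ?_
    have h2 : ∫ u, (Ioi (threshold (β / α) y x)).indicator
        (fun u : ℝ≥0 => Real.exp (-(s * u))) u ∂μ ≤ μ.real (Ioi (threshold (β / α) y x)) := by
      rw [← integral_indicator_one measurableSet_Ioi]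
      refine integral_mono (integrable_exp_indicator_Ioi hμ hs hz) ?_ fun u => ?_
      · rw [integrable_indicator_iff measurableSet_Ioi]
        exact integrableOn_const hfin
      · exact indicator_le_indicator (exp_neg_mul_le_one hs u)
    refine h2.trans ((hC _ hz).trans_eq ?_)
    rw [threshold_rpow_neg hα hβ hy hx, mul_assoc]

theorem LaplaceAttracted.tendsto_integral_deficit {α β K : ℝ} {Q : Measure ℝ≥0}
    [IsProbabilityMeasure Q] (h : LaplaceAttracted β K Q) (hα : 0 < α) (hβ : 0 < β)
    (hβ1 : β < 1) (hK : 0 < K) {ω : Measure ℝ} [IsProbabilityMeasure ω]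
    (hω : Integrable (fun x : ℝ => max x 0 ^ α) ω) {s y : ℝ} (hs : 0 ≤ s) (hy : 0 < y) :
    Tendsto (fun n => ∫ x, ∫ u, deficit (β / α) s y x u ∂(rescaled β Q n) ∂ω) atTop
      (𝓝 (jumpExponent α β K ω s y)) := by
  have H := h.laplaceTendsto hβ hβ1 hK
  obtain ⟨C, -, hC⟩ := h.exists_tail_bound hβ hβ1 hK
  obtain ⟨M, hM⟩ := (H.tendsto s hs).bddAbove_range
  refine tendsto_integral_of_dominated_convergence
    (fun x => M + C * y ^ (-α) * max x 0 ^ α)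
    (fun n => (stronglyMeasurable_integral_deficit _ _ _ _).aestronglyMeasurable)
    ((integrable_const _).add (hω.const_mul _))
    (fun n => ae_of_all _ fun x => ?_)
    (ae_of_all _ fun x => H.tendsto_deficit x (div_pos hβ hα) hs hy)
  exact abs_integral_deficit_le hα hβ (H.integrable n) hs hy (hM (mem_range_self n)) (hC n) x

/-! ### Expectations of semicharacters -/

theorem semichar_embed (s : ℝ≥0) (y : ℝ) (p : ℝ≥0 × ℝ) :
    semichar s y (embed p) = (Iic y).indicator (fun _ => Real.exp (-((s : ℝ) * p.1))) p.2 := by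
  by_cases h : p.2 ≤ y
  · rw [semichar, embed, indicator_of_mem (by simpa using h), indicator_of_mem (by simpa using h)]
  · rw [semichar, embed, indicator_of_notMem (by simpa using h),
      indicator_of_notMem (by simpa using h)]

theorem semichar_nonneg (s : ℝ≥0) (y : EReal) (p : ℝ≥0 × EReal) : 0 ≤ semichar s y p :=
  indicator_nonneg (fun _ _ => (Real.exp_pos _).le) _

theorem semichar_le_one (s : ℝ≥0) (y : EReal) (p : ℝ≥0 × EReal) : semichar s y p ≤ 1 :=
  (indicator_le_self' (fun _ _ => (Real.exp_pos _).le) _).trans (exp_neg_mul_le_one s.2 _)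

theorem measurable_semichar (s : ℝ≥0) (y : EReal) : Measurable (semichar s y) := by
  have h : Measurable fun p : ℝ≥0 × EReal => Real.exp (-((s : ℝ) * (p.1 : ℝ))) := by fun_prop
  exact h.indicator (s := {p : ℝ≥0 × EReal | p.2 ∈ Iic y}) (measurable_snd measurableSet_Iic)

theorem measurable_embed : Measurable embed :=
  measurable_fst.prodMk (measurable_coe_real_ereal.comp measurable_snd)

theorem integrable_semichar (s : ℝ≥0) (y : EReal) (μ : Measure (ℝ≥0 × EReal)) [IsFiniteMeasure μ] :
    Integrable (semichar s y) μ :=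
  Integrable.of_bound (measurable_semichar s y).aestronglyMeasurable 1 (ae_of_all _ fun p => by
    rw [Real.norm_eq_abs, abs_of_nonneg (semichar_nonneg s y p)]; exact semichar_le_one s y p)

theorem semichar_embed_rpow (γ : ℝ) (s : ℝ≥0) (y x : ℝ) (u : ℝ≥0) :
    semichar s y (embed (u, (u : ℝ) ^ γ * x)) = 1 - deficit γ s y x u := by
  rw [semichar_embed, deficit, sub_sub_cancel]
  rfl

theorem compProd_scaledKernel (γ : ℝ) (ω : Measure ℝ) [IsProbabilityMeasure ω]
    (Q : Measure ℝ≥0) [SFinite Q] :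
    Q ⊗ₘ scaledKernel γ ω = (Q.prod ω).map fun p => (p.1, (p.1 : ℝ) ^ γ * p.2) := by
  ext S hS
  rw [Measure.compProd_apply hS, Measure.map_apply (by fun_prop) hS,
    Measure.prod_apply (by exact (by fun_prop : Measurable fun p : ℝ≥0 × ℝ =>
      (p.1, (p.1 : ℝ) ^ γ * p.2)) hS)]
  refine lintegral_congr fun t => ?_
  change (ω.map fun x => (t : ℝ) ^ γ * x) _ = _
  rw [Measure.map_apply (by fun_prop) (measurable_prodMk_left hS)]
  rfl

/-- The semicharacter of a maximum and a sum is the product of the semicharacters. -/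
theorem semichar_normalizedPair {Ω : Type*} (α β : ℝ) (W : ℕ → Ω → ℝ≥0) (J : ℕ → Ω → ℝ) {n : ℕ}
    (hn : 0 < n) (s : ℝ≥0) (y : ℝ) (x : Ω) :
    semichar s y (embed (normalizedPair α β W J n x)) = ∏ i : Fin n, semichar s y
      (embed ((n : ℝ≥0) ^ (-(1 / β)) * W i x, (n : ℝ) ^ (-(1 / α)) * J i x)) := by
  have : Nonempty (Fin n) := ⟨⟨0, hn⟩⟩
  have ha : 0 ≤ (n : ℝ) ^ (-(1 / α)) := by positivity
  have hmax : (n : ℝ) ^ (-(1 / α)) * partialMax J n x ≤ y ↔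
      ∀ i : Fin n, (n : ℝ) ^ (-(1 / α)) * J i x ≤ y := by
    rw [partialMax, Real.mul_iSup_of_nonneg ha, ciSup_le_iff (finite_range _).bddAbove]
  simp only [semichar_embed, normalizedPair]
  by_cases h : ∀ i : Fin n, (n : ℝ) ^ (-(1 / α)) * J i x ≤ y
  · rw [indicator_of_mem (by exact hmax.2 h), Finset.prod_congr rfl fun i _ =>
      indicator_of_mem (by exact h i) _, ← Real.exp_sum, partialSum, Finset.sum_range]
    push_cast
    rw [Finset.mul_sum, Finset.mul_sum, Finset.sum_neg_distrib]
  · rw [indicator_of_notMem (by simpa only [mem_Iic, hmax] using h)]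
    push Not at h
    obtain ⟨i, hi⟩ := h
    exact (Finset.prod_eq_zero (Finset.mem_univ i)
      (indicator_of_notMem (s := Iic y) (by simpa using hi) _)).symm

theorem integral_semichar_normalizedPair {Ω : Type*} [MeasurableSpace Ω] {P : Measure Ω}
    {W : ℕ → Ω → ℝ≥0} {J : ℕ → Ω → ℝ} (hWm : ∀ i, Measurable (W i))
    (hJm : ∀ i, Measurable (J i)) (h : IsIID (fun i x => (W i x, J i x)) P) (α β : ℝ)
    {n : ℕ} (hn : 0 < n) (s : ℝ≥0) (y : ℝ) :
    ∫ x, semichar s y (embed (normalizedPair α β W J n x)) ∂P =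
      (∫ x, semichar s y (embed ((n : ℝ≥0) ^ (-(1 / β)) * W 0 x,
        (n : ℝ) ^ (-(1 / α)) * J 0 x)) ∂P) ^ n := by
  set f : ℝ≥0 × ℝ → ℝ := fun p => semichar s y (embed ((n : ℝ≥0) ^ (-(1 / β)) * p.1,
    (n : ℝ) ^ (-(1 / α)) * p.2)) with hf
  have hfm : Measurable f :=
    (measurable_semichar s y).comp (measurable_embed.comp (by fun_prop))
  simp only [semichar_normalizedPair α β W J hn]
  have hind : iIndepFun (fun (i : Fin n) x => (W i x, J i x)) P :=
    h.1.precomp (g := fun i : Fin n => (i : ℕ)) Fin.val_injective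
  have h1 := hind.integral_fun_prod_comp (f := fun _ => f)
    (fun i => ((hWm i).prodMk (hJm i)).aemeasurable) (fun i => hfm.aestronglyMeasurable)
  refine h1.trans ?_
  have h2 : ∀ i : ℕ, ∫ x, f (W i x, J i x) ∂P = ∫ x, f (W 0 x, J 0 x) ∂P := fun i =>
    ((h.2 i).comp hfm).integral_eq
  refine (Finset.prod_congr rfl fun (i : Fin n) _ => h2 i).trans ?_
  simp only [Finset.prod_const, Finset.card_univ, Fintype.card_fin, hf]

theorem map_pair_eq_of_condDistrib {Ω : Type*} [MeasurableSpace Ω] {P : Measure Ω}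
    [IsProbabilityMeasure P] {W : Ω → ℝ≥0} {J : Ω → ℝ} (hW : Measurable W) (hJ : Measurable J)
    {γ : ℝ} {ω : Measure ℝ} [IsProbabilityMeasure ω]
    (hcond : ∀ᵐ t ∂(P.map W), condDistrib J W P t = ω.map (fun x : ℝ => (t : ℝ) ^ γ * x)) :
    P.map (fun a => (W a, J a)) =
      ((P.map W).prod ω).map fun p => (p.1, (p.1 : ℝ) ^ γ * p.2) := by
  have := Measure.isProbabilityMeasure_map (μ := P) hW.aemeasurable
  rw [← compProd_map_condDistrib hJ.aemeasurable, ← compProd_scaledKernel]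
  exact Measure.compProd_congr hcond

/-- The scaling relation `n^{-1/α} t^{β/α} = (n^{-1/β} t)^{β/α}` turns the expectation of a
normalized semicharacter into an integral of the deficit against `n P(n^{-1/β} W ∈ ·) ⊗ ω`. -/
theorem nat_mul_integral_semichar_sub_one {Ω : Type*} [MeasurableSpace Ω] {P : Measure Ω}
    [IsProbabilityMeasure P] {W : Ω → ℝ≥0} {J : Ω → ℝ} (hW : Measurable W) (hJ : Measurable J)
    {α β : ℝ} (hβ : 0 < β) {ω : Measure ℝ} [IsProbabilityMeasure ω]
    (hlaw : P.map (fun a => (W a, J a)) =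
      ((P.map W).prod ω).map fun p => (p.1, (p.1 : ℝ) ^ (β / α) * p.2))
    {n : ℕ} (hn : 0 < n) (s : ℝ≥0) (y : ℝ) :
    (n : ℝ) * (∫ a, semichar s y (embed ((n : ℝ≥0) ^ (-(1 / β)) * W a,
      (n : ℝ) ^ (-(1 / α)) * J a)) ∂P - 1) =
      -∫ x, ∫ u, deficit (β / α) s y x u ∂(rescaled β (P.map W) n) ∂ω := by
  have hQ := Measure.isProbabilityMeasure_map (μ := P) hW.aemeasurable
  set b : ℝ≥0 := (n : ℝ≥0) ^ (-(1 / β)) with hb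
  have hscale : ∀ t : ℝ≥0, (n : ℝ) ^ (-(1 / α)) * (t : ℝ) ^ (β / α) =
      ((b * t : ℝ≥0) : ℝ) ^ (β / α) := by
    intro t
    rw [NNReal.coe_mul, Real.mul_rpow (by positivity) (by positivity), hb, NNReal.coe_rpow,
      ← Real.rpow_mul (by positivity), NNReal.coe_natCast]
    congr 2
    field_simp
  have hf : Measurable fun p : ℝ≥0 × ℝ =>
      semichar s y (embed (b * p.1, (n : ℝ) ^ (-(1 / α)) * p.2)) :=
    (measurable_semichar s y).comp (measurable_embed.comp (by fun_prop))
  have h1 : ∫ a, semichar s y (embed (b * W a, (n : ℝ) ^ (-(1 / α)) * J a)) ∂P =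
      ∫ p : ℝ≥0 × ℝ, (1 - deficit (β / α) s y p.2 (b * p.1)) ∂((P.map W).prod ω) := by
    rw [← integral_map (f := fun p : ℝ≥0 × ℝ =>
      semichar s y (embed (b * p.1, (n : ℝ) ^ (-(1 / α)) * p.2)))
      (hW.prodMk hJ).aemeasurable hf.aestronglyMeasurable, hlaw,
      integral_map (by fun_prop) hf.aestronglyMeasurable]
    refine integral_congr_ae (ae_of_all _ fun p => ?_)
    simp only
    rw [← mul_assoc, hscale, semichar_embed_rpow]
  have hdm : Measurable fun p : ℝ≥0 × ℝ => deficit (β / α) s y p.2 (b * p.1) :=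
    Measurable.comp (g := fun p : ℝ≥0 × ℝ => deficit (β / α) s y p.2 p.1)
      (f := fun p : ℝ≥0 × ℝ => (b * p.1, p.2)) (measurable_deficit (β / α) s y)
      ((measurable_const.mul measurable_fst).prodMk measurable_snd)
  have hdint : Integrable (fun p : ℝ≥0 × ℝ => deficit (β / α) s y p.2 (b * p.1))
      ((P.map W).prod ω) :=
    Integrable.of_bound hdm.aestronglyMeasurable 1 (ae_of_all _ fun p => by
      rw [Real.norm_eq_abs, abs_of_nonneg (deficit_nonneg s.coe_nonneg _)]; exact deficit_le_one _)
  have hres : ∀ x, ∫ u, deficit (β / α) s y x u ∂(rescaled β (P.map W) n) =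
      n * ∫ t, deficit (β / α) s y x (b * t) ∂(P.map W) := fun x =>
    integral_rescaled β (P.map W) n (f := deficit (β / α) s y x)
      ((measurable_deficit (β / α) s y).comp measurable_prodMk_right)
  have hswap := integral_prod_symm _ hdint
  have hone : ∫ _ : ℝ≥0 × ℝ, (1 : ℝ) ∂((P.map W).prod ω) = 1 := by simp
  simp only [hres]
  rw [h1, integral_sub (integrable_const _) hdint, hone, hswap, integral_const_mul]
  ring

theorem tendsto_integral_semichar_pow {Ω : Type*} [MeasurableSpace Ω] {P : Measure Ω}
    [IsProbabilityMeasure P] {W : Ω → ℝ≥0} {J : Ω → ℝ} (hW : Measurable W) (hJ : Measurable J)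
    {α β K : ℝ} (hα : 0 < α) (hβ : 0 < β) (hβ1 : β < 1) (hK : 0 < K)
    {ω : Measure ℝ} [IsProbabilityMeasure ω] (hω : Integrable (fun x : ℝ => max x 0 ^ α) ω)
    (hlaw : P.map (fun a => (W a, J a)) =
      ((P.map W).prod ω).map fun p => (p.1, (p.1 : ℝ) ^ (β / α) * p.2))
    (hatt : LaplaceAttracted β K (P.map W)) (s : ℝ≥0) {y : ℝ} (hy : 0 < y) :
    Tendsto (fun n : ℕ => (∫ a, semichar s y (embed ((n : ℝ≥0) ^ (-(1 / β)) * W a,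
      (n : ℝ) ^ (-(1 / α)) * J a)) ∂P) ^ n) atTop
      (𝓝 (Real.exp (-jumpExponent α β K ω s y))) := by
  have hQ := Measure.isProbabilityMeasure_map (μ := P) hW.aemeasurable
  have h := (hatt.tendsto_integral_deficit hα hβ hβ1 hK hω s.2 hy).neg
  refine (Real.tendsto_one_add_pow_exp_of_tendsto (h.congr' ?_)).congr fun n => by
    rw [add_sub_cancel]
  filter_upwards [eventually_gt_atTop 0] with n hn
  exact (nat_mul_integral_semichar_sub_one hW hJ hβ hlaw hn s y).symm

/-- Convergence in distribution of the normalized sums gives convergence of Laplace transforms. -/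
theorem StrictDONA.laplaceAttracted {Ω Ω' : Type*} [MeasurableSpace Ω] [MeasurableSpace Ω']
    {P : Measure Ω} [IsProbabilityMeasure P] {P' : Measure Ω'} [IsProbabilityMeasure P']
    {β K : ℝ} {D : Ω' → ℝ≥0} (hDm : Measurable D)
    (hD : ∀ s : ℝ, 0 ≤ s →
      ∫ x, Real.exp (-(s * (D x : ℝ))) ∂P' = Real.exp (-(K * Real.Gamma (1 - β) * s ^ β)))
    {W : ℕ → Ω → ℝ≥0} (hWm : ∀ i, Measurable (W i)) (h : StrictDONA β W P D P') :
    LaplaceAttracted β K (P.map (W 0)) := by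
  intro s hs
  set f : BoundedContinuousFunction ℝ≥0 ℝ := BoundedContinuousFunction.ofNormedAddCommGroup
    (fun u : ℝ≥0 => Real.exp (-(s * u))) (by fun_prop) 1 (fun u => by
      rw [Real.norm_eq_abs, abs_of_pos (Real.exp_pos _)]; exact exp_neg_mul_le_one hs u) with hf
  have hfu : ∀ u, f u = Real.exp (-(s * u)) := fun u => rfl
  have h1 := ProbabilityMeasure.tendsto_iff_forall_integral_tendsto.1 h.2.tendsto f
  have hlim : ∫ u, f u ∂(P'.map D) = Real.exp (-(K * Real.Gamma (1 - β) * s ^ β)) := by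
    rw [integral_map hDm.aemeasurable f.continuous.measurable.aestronglyMeasurable, ← hD s hs]
    rfl
  have hpre : ∀ n : ℕ, ∫ u, f u ∂(P.map fun x => (n : ℝ≥0) ^ (-(1 / β)) * partialSum W n x) =
      (∫ t : ℝ≥0, Real.exp (-(s * ((n : ℝ≥0) ^ (-(1 / β)) * t : ℝ≥0))) ∂(P.map (W 0))) ^ n := by
    intro n
    have hg : Measurable fun t : ℝ≥0 => Real.exp (-(s * ((n : ℝ≥0) ^ (-(1 / β)) * t : ℝ≥0))) := by
      fun_prop
    rw [integral_map (h.2.forall_aemeasurable n) f.continuous.measurable.aestronglyMeasurable,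
      integral_map (hWm 0).aemeasurable hg.aestronglyMeasurable]
    have hind : iIndepFun (fun (i : Fin n) x => W i x) P :=
      h.1.1.precomp (g := fun i : Fin n => (i : ℕ)) Fin.val_injective
    have h2 := hind.integral_fun_prod_comp
      (f := fun _ t => Real.exp (-(s * ((n : ℝ≥0) ^ (-(1 / β)) * t : ℝ≥0))))
      (fun i => (hWm i).aemeasurable) (fun i => hg.aestronglyMeasurable)
    have h3 : ∀ i : ℕ, ∫ x, Real.exp (-(s * ((n : ℝ≥0) ^ (-(1 / β)) * W i x : ℝ≥0))) ∂P =
        ∫ x, Real.exp (-(s * ((n : ℝ≥0) ^ (-(1 / β)) * W 0 x : ℝ≥0))) ∂P := fun i =>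
      ((h.1.2 i).comp hg).integral_eq
    simp only [h3, Finset.prod_const, Finset.card_univ, Fintype.card_fin] at h2
    rw [← h2]
    refine integral_congr_ae (ae_of_all _ fun x => ?_)
    simp only [hfu]
    rw [← Real.exp_sum, partialSum, Finset.sum_range, Finset.mul_sum]
    push_cast
    rw [Finset.mul_sum, Finset.sum_neg_distrib]
  rw [← hlim]
  exact h1.congr hpre

/-! ### The continuity theorem for CDF-Laplace transforms -/

/-- A finite measure on `[0, ∞)` is determined by its Laplace transform: the
polynomials in `e^{-u}` form a point-separating algebra. -/
theorem ext_of_laplace {μ ν : Measure ℝ≥0} [IsFiniteMeasure μ] [IsFiniteMeasure ν]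
    (h : ∀ s : ℝ≥0, ∫ u : ℝ≥0, Real.exp (-((s : ℝ) * u)) ∂μ =
      ∫ u : ℝ≥0, Real.exp (-((s : ℝ) * u)) ∂ν) : μ = ν := by
  set f : BoundedContinuousFunction ℝ≥0 ℝ := BoundedContinuousFunction.ofNormedAddCommGroup
    (fun u : ℝ≥0 => Real.exp (-(u : ℝ))) (by fun_prop) 1 (fun u => by
      rw [Real.norm_eq_abs, abs_of_pos (Real.exp_pos _)]
      exact Real.exp_le_one_iff.2 (by simp)) with hf
  have hfu : ∀ u, f u = Real.exp (-(u : ℝ)) := fun u => rfl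
  let A : StarSubalgebra ℝ (BoundedContinuousFunction ℝ≥0 ℝ) :=
    { (Polynomial.aeval f).range with
      star_mem' := fun {a} ha => by
        have h : star a = a := by ext u; exact star_trivial (a u)
        rw [h]; exact ha }
  have hfA : f ∈ A := ⟨Polynomial.X, Polynomial.aeval_X f⟩
  refine ext_of_forall_mem_subalgebra_integral_eq_of_pseudoEMetric_complete_countable
    (A := A) (𝕜 := ℝ) ?_ ?_
  · intro x y hxy
    refine ⟨f, ⟨f.toContinuousMap, ⟨f, hfA, rfl⟩, rfl⟩, fun hc => hxy ?_⟩
    have hc' : f x = f y := hc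
    rw [hfu, hfu, Real.exp_eq_exp, neg_inj, NNReal.coe_inj] at hc'
    exact hc'
  · rintro g ⟨p, rfl⟩
    change ∫ x, (Polynomial.aeval f p) x ∂μ = ∫ x, (Polynomial.aeval f p) x ∂ν
    induction p using Polynomial.induction_on' with
    | add p q hp hq =>
      have hadd : ∀ x, (Polynomial.aeval f (p + q)) x =
          (Polynomial.aeval f p) x + (Polynomial.aeval f q) x := fun x => by rw [map_add]; rfl
      simp only [hadd]
      rw [integral_add (BoundedContinuousFunction.integrable _ _)
        (BoundedContinuousFunction.integrable _ _), integral_add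
        (BoundedContinuousFunction.integrable _ _) (BoundedContinuousFunction.integrable _ _),
        hp, hq]
    | monomial k c =>
      have hmon : ∀ x, (Polynomial.aeval f (Polynomial.monomial k c)) x =
          c * Real.exp (-(((k : ℝ≥0) : ℝ) * x)) := fun x => by
        rw [Polynomial.aeval_monomial, ← Algebra.smul_def, BoundedContinuousFunction.smul_apply,
          BoundedContinuousFunction.pow_apply, hfu, ← Real.exp_nat_mul, smul_eq_mul]
        congr 2
        push_cast
        ring
      simp only [hmon]
      rw [integral_const_mul, integral_const_mul, h]

theorem measurable_semichar_embed (s : ℝ≥0) (y : EReal) :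
    Measurable fun p : ℝ≥0 × ℝ => semichar s y (embed p) :=
  (measurable_semichar s y).comp measurable_embed

theorem integrable_semichar_embed (s : ℝ≥0) (y : EReal) (μ : Measure (ℝ≥0 × ℝ))
    [IsFiniteMeasure μ] : Integrable (fun p => semichar s y (embed p)) μ :=
  Integrable.of_bound (measurable_semichar_embed s y).aestronglyMeasurable 1
    (ae_of_all _ fun p => by
      rw [Real.norm_eq_abs, abs_of_nonneg (semichar_nonneg s y _)]
      exact semichar_le_one s y _)

theorem clTransform_map_embed (μ : Measure (ℝ≥0 × ℝ)) (s : ℝ≥0) (y : EReal) :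
    clTransform (μ.map embed) s y = ∫ p, semichar s y (embed p) ∂μ :=
  integral_map measurable_embed.aemeasurable (measurable_semichar s y).aestronglyMeasurable

/-- The C-L transform of a finite measure is right-continuous in the second variable. -/
theorem tendsto_integral_semichar_embed_right (μ : Measure (ℝ≥0 × ℝ)) [IsFiniteMeasure μ]
    (s : ℝ≥0) (y : ℝ) :
    Tendsto (fun y' : ℝ => ∫ p, semichar s y' (embed p) ∂μ) (𝓝[>] y)
      (𝓝 (∫ p, semichar s y (embed p) ∂μ)) := by
  refine tendsto_integral_filter_of_dominated_convergence (fun _ => 1)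
    (Eventually.of_forall fun y' => (measurable_semichar_embed s y').aestronglyMeasurable)
    (Eventually.of_forall fun y' => ae_of_all _ fun p => by
      rw [Real.norm_eq_abs, abs_of_nonneg (semichar_nonneg s y' _)]
      exact semichar_le_one s y' _) (integrable_const _) (ae_of_all _ fun p => ?_)
  refine tendsto_nhds_of_eventually_eq ?_
  simp only [semichar_embed]
  rcases le_or_gt p.2 y with h | h
  · filter_upwards [self_mem_nhdsWithin] with y' (hy' : y < y')
    rw [indicator_of_mem (by exact h.trans hy'.le), indicator_of_mem (by exact h)]
  · filter_upwards [nhdsWithin_le_nhds (gt_mem_nhds h)] with y' hy'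
    rw [indicator_of_notMem (by simpa using hy'), indicator_of_notMem (by simpa using h)]

theorem integral_semichar_embed_eq_laplace (μ : Measure (ℝ≥0 × ℝ)) (s : ℝ≥0) (y : ℝ) :
    ∫ p, semichar s y (embed p) ∂μ =
      ∫ u : ℝ≥0, Real.exp (-((s : ℝ) * u)) ∂((μ.restrict (univ ×ˢ Iic y)).map Prod.fst) := by
  rw [integral_map (by fun_prop) (by fun_prop), ← integral_indicator
    (MeasurableSet.univ.prod measurableSet_Iic)]
  refine integral_congr_ae (ae_of_all _ fun p => ?_)
  simp only [semichar_embed]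
  by_cases h : p.2 ≤ y
  · rw [indicator_of_mem (by exact h), indicator_of_mem (by simpa using h)]
  · rw [indicator_of_notMem (by simpa using h), indicator_of_notMem (by simpa using h)]

theorem ext_of_integral_semichar {μ ν : Measure (ℝ≥0 × ℝ)} [IsFiniteMeasure μ]
    [IsFiniteMeasure ν] (h : ∀ (s : ℝ≥0) (y : ℝ), y ≠ 0 →
      ∫ p, semichar s y (embed p) ∂μ = ∫ p, semichar s y (embed p) ∂ν) : μ = ν := by
  have hall : ∀ (s : ℝ≥0) (y : ℝ),
      ∫ p, semichar s y (embed p) ∂μ = ∫ p, semichar s y (embed p) ∂ν := by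
    intro s y
    rcases eq_or_ne y 0 with rfl | hy
    · refine tendsto_nhds_unique (tendsto_integral_semichar_embed_right μ s 0)
        ((tendsto_integral_semichar_embed_right ν s 0).congr' ?_)
      filter_upwards [self_mem_nhdsWithin] with y (hy : 0 < y)
      exact (h s y hy.ne').symm
    · exact h s y hy
  have hIic : ∀ (y : ℝ) {B : Set ℝ≥0}, MeasurableSet B →
      μ (B ×ˢ Iic y) = ν (B ×ˢ Iic y) := by
    intro y B hB
    have h1 : (μ.restrict (univ ×ˢ Iic y)).map Prod.fst =
        (ν.restrict (univ ×ˢ Iic y)).map Prod.fst := ext_of_laplace fun s => by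
      rw [← integral_semichar_embed_eq_laplace, ← integral_semichar_embed_eq_laplace, hall]
    have h2 : ∀ μ : Measure (ℝ≥0 × ℝ), (μ.restrict (univ ×ˢ Iic y)).map Prod.fst B =
        μ (B ×ˢ Iic y) := fun μ => by
      rw [Measure.map_apply measurable_fst hB, Measure.restrict_apply (measurable_fst hB)]
      congr 1
      ext p
      simp
    rw [← h2 μ, ← h2 ν, h1]
  refine Measure.ext_prod fun {B C} hB hC => ?_
  have h2 : ∀ (μ : Measure (ℝ≥0 × ℝ)) {C : Set ℝ}, MeasurableSet C →
      (μ.restrict (B ×ˢ univ)).map Prod.snd C = μ (B ×ˢ C) := fun μ C hC => by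
    rw [Measure.map_apply measurable_snd hC, Measure.restrict_apply (measurable_snd hC)]
    congr 1
    ext p
    simp [and_comm]
  have h3 : (μ.restrict (B ×ˢ univ)).map Prod.snd = (ν.restrict (B ×ˢ univ)).map Prod.snd :=
    Measure.ext_of_Iic _ _ fun y => by
      rw [h2 μ measurableSet_Iic, h2 ν measurableSet_Iic, hIic y hB]
  rw [← h2 μ hC, ← h2 ν hC, h3]

/-- Along any filter, a weak limit inherits the limit of the C-L transforms: indicators are
squeezed between continuous ramps, and the limit is right-continuous. -/
theorem integral_semichar_eq_of_tendsto {ι : Type*} {F : Filter ι} [F.NeBot]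
    {ν : ι → ProbabilityMeasure (ℝ≥0 × ℝ)} {μ : ProbabilityMeasure (ℝ≥0 × ℝ)}
    (hν : Tendsto ν F (𝓝 μ)) {L : ℝ → ℝ} {s : ℝ≥0}
    (hL : ∀ y : ℝ, y ≠ 0 → Tendsto (fun n => ∫ p, semichar s y (embed p) ∂(ν n : Measure _)) F
      (𝓝 (L y)))
    (hLr : ∀ y : ℝ, y ≠ 0 → Tendsto L (𝓝[>] y) (𝓝 (L y))) {y : ℝ} (hy : y ≠ 0) :
    ∫ p, semichar s y (embed p) ∂(μ : Measure (ℝ≥0 × ℝ)) = L y := by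
  have hcont : ∀ y y' : ℝ, y < y' → ∃ f : BoundedContinuousFunction (ℝ≥0 × ℝ) ℝ,
      (∀ p, semichar s y (embed p) ≤ f p) ∧ ∀ p, f p ≤ semichar s y' (embed p) := by
    intro y y' hyy
    have hc : Continuous fun p : ℝ≥0 × ℝ =>
        Real.exp (-((s : ℝ) * p.1)) * ramp y' (y' - y) p.2 :=
      Continuous.mul (by fun_prop) ((continuous_ramp _ _).comp continuous_snd)
    refine ⟨BoundedContinuousFunction.ofNormedAddCommGroup _ hc 1 fun p => ?_, fun p => ?_,
      fun p => ?_⟩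
    · rw [Real.norm_eq_abs, abs_of_nonneg (mul_nonneg (Real.exp_pos _).le (ramp_nonneg _ _ _))]
      exact mul_le_one₀ (exp_neg_mul_le_one s.2 _) (ramp_nonneg _ _ _) (ramp_le_one _ _ _)
    · rw [semichar_embed]
      change _ ≤ Real.exp (-((s : ℝ) * p.1)) * ramp y' (y' - y) p.2
      by_cases h : p.2 ≤ y
      · rw [indicator_of_mem (by exact h), ramp_eq_one (by linarith) (by linarith), mul_one]
      · rw [indicator_of_notMem (by simpa using h)]
        exact mul_nonneg (Real.exp_pos _).le (ramp_nonneg _ _ _)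
    · rw [semichar_embed]
      change Real.exp (-((s : ℝ) * p.1)) * ramp y' (y' - y) p.2 ≤ _
      by_cases h : p.2 ≤ y'
      · rw [indicator_of_mem (by exact h)]
        exact mul_le_of_le_one_right (Real.exp_pos _).le (ramp_le_one _ _ _)
      · rw [indicator_of_notMem (by simpa using h), ramp_eq_zero (by linarith) (by linarith),
          mul_zero]
  have hT := ProbabilityMeasure.tendsto_iff_forall_integral_tendsto.1 hν
  have hle : ∀ y y' : ℝ, y < y' → y' ≠ 0 →
      ∫ p, semichar s y (embed p) ∂(μ : Measure (ℝ≥0 × ℝ)) ≤ L y' := by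
    intro y y' hyy hy'
    obtain ⟨f, h1, h2⟩ := hcont y y' hyy
    refine (integral_mono (integrable_semichar_embed _ _ _) (f.integrable _) h1).trans ?_
    exact le_of_tendsto_of_tendsto' (hT f) (hL y' hy') fun n =>
      integral_mono (f.integrable _) (integrable_semichar_embed _ _ _) h2
  have hge : ∀ y y' : ℝ, y < y' → y ≠ 0 →
      L y ≤ ∫ p, semichar s y' (embed p) ∂(μ : Measure (ℝ≥0 × ℝ)) := by
    intro y y' hyy hy
    obtain ⟨f, h1, h2⟩ := hcont y y' hyy
    refine le_trans ?_ (integral_mono (f.integrable _) (integrable_semichar_embed _ _ _) h2)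
    exact le_of_tendsto_of_tendsto' (hL y hy) (hT f) fun n =>
      integral_mono (integrable_semichar_embed _ _ _) (f.integrable _) h1
  refine le_antisymm (ge_of_tendsto (hLr y hy) ?_)
    (ge_of_tendsto (tendsto_integral_semichar_embed_right _ s y) ?_)
  · filter_upwards [self_mem_nhdsWithin,
      nhdsWithin_le_nhds (isOpen_ne.mem_nhds hy)] with y' h1 h2 using hle y y' h1 h2
  · filter_upwards [self_mem_nhdsWithin] with y' h1 using hge y y' h1 hy

theorem integral_semichar_zero (μ : Measure (ℝ≥0 × ℝ)) (y : ℝ) :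
    ∫ p, semichar 0 y (embed p) ∂μ = μ.snd.real (Iic y) := by
  rw [measureReal_def, Measure.snd_apply measurableSet_Iic, ← measureReal_def,
    ← integral_indicator_one (measurable_snd measurableSet_Iic)]
  refine integral_congr_ae (ae_of_all _ fun p => ?_)
  simp only [semichar_embed, NNReal.coe_zero, zero_mul, neg_zero, Real.exp_zero]
  rfl

/-- Continuity theorem: if the first marginals converge and the C-L transforms converge to a
right-continuous function without loss of mass, then the measures converge weakly. Tightness
provides cluster points, and their C-L transform identifies them. -/
theorem exists_tendsto_of_tendsto_semichar {ν : ℕ → ProbabilityMeasure (ℝ≥0 × ℝ)}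
    {ρ : ProbabilityMeasure ℝ≥0}
    (hfst : Tendsto (fun n => (ν n).map measurable_fst.aemeasurable) atTop (𝓝 ρ))
    {L : ℝ≥0 → ℝ → ℝ}
    (hL : ∀ (s : ℝ≥0) (y : ℝ), y ≠ 0 →
      Tendsto (fun n => ∫ p, semichar s y (embed p) ∂(ν n : Measure _)) atTop (𝓝 (L s y)))
    (hLr : ∀ (s : ℝ≥0) (y : ℝ), y ≠ 0 → Tendsto (L s) (𝓝[>] y) (𝓝 (L s y)))
    (hL1 : Tendsto (L 0) atTop (𝓝 1)) (hL0 : ∀ y < 0, L 0 y = 0) :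
    ∃ μ : ProbabilityMeasure (ℝ≥0 × ℝ), Tendsto ν atTop (𝓝 μ) ∧
      (μ : Measure (ℝ≥0 × ℝ)).fst = ρ ∧
      ∀ (s : ℝ≥0) (y : ℝ), y ≠ 0 → ∫ p, semichar s y (embed p) ∂(μ : Measure _) = L s y := by
  have htight : IsTightMeasureSet {((m : ProbabilityMeasure (ℝ≥0 × ℝ)) : Measure (ℝ≥0 × ℝ)) |
      m ∈ range ν} := by
    refine IsTightMeasureSet.prodMk ?_ ?_
    · have hc : IsCompact (closure (range fun n => (ν n).map measurable_fst.aemeasurable)) :=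
        hfst.isCompact_insert_range.closure_of_subset (subset_insert _ _)
      refine (isTightMeasureSet_of_isCompact_closure hc).subset ?_
      rintro _ ⟨_, ⟨_, ⟨n, rfl⟩, rfl⟩, rfl⟩
      exact ⟨_, ⟨n, rfl⟩, rfl⟩
    · have h1 : IsTightMeasureSet (range fun n => (ν n : Measure (ℝ≥0 × ℝ)).snd) := by
        refine isTightMeasureSet_range_of_tendsto_limsup_measure_norm_gt ?_
        have hlim : Tendsto (fun r : ℝ => ENNReal.ofReal (1 - L 0 r)) atTop (𝓝 0) := by
          have := ENNReal.tendsto_ofReal (hL1.const_sub 1)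
          simpa using this
        refine tendsto_of_tendsto_of_tendsto_of_le_of_le' tendsto_const_nhds hlim
          (Eventually.of_forall fun r => zero_le) ?_
        filter_upwards [eventually_gt_atTop 0] with r hr
        have h2 : Tendsto (fun n => ENNReal.ofReal
            (1 - ∫ p, semichar 0 r (embed p) ∂(ν n : Measure (ℝ≥0 × ℝ)) +
              ∫ p, semichar 0 (-r : ℝ) (embed p) ∂(ν n : Measure (ℝ≥0 × ℝ)))) atTop
            (𝓝 (ENNReal.ofReal (1 - L 0 r))) := by
          have := ENNReal.tendsto_ofReal (((hL 0 r hr.ne').const_sub 1).add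
            (hL 0 (-r) (neg_ne_zero.2 hr.ne')))
          rwa [hL0 (-r) (by linarith), add_zero] at this
        rw [← h2.limsup_eq]
        refine limsup_le_limsup (Eventually.of_forall fun n => ?_)
        simp only [integral_semichar_zero]
        have hsub : {x : ℝ | r < ‖x‖} ⊆ (Iic r)ᶜ ∪ Iic (-r) := by
          intro x (hx : r < ‖x‖)
          rw [Real.norm_eq_abs, lt_abs] at hx
          rcases hx with h | h
          · left; simpa using h
          · right; simp only [mem_Iic]; linarith
        refine (measure_mono hsub).trans ((measure_union_le _ _).trans ?_)
        rw [ENNReal.ofReal_add (by simp) measureReal_nonneg,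
          ← probReal_compl_eq_one_sub measurableSet_Iic, ofReal_measureReal, ofReal_measureReal]
      refine h1.subset ?_
      rintro _ ⟨_, ⟨_, ⟨n, rfl⟩, rfl⟩, rfl⟩
      exact ⟨n, rfl⟩
  have hcomp := isCompact_closure_of_isTightMeasureSet htight
  have hid : ∀ (U : Ultrafilter ℕ) (μ : ProbabilityMeasure (ℝ≥0 × ℝ)), (U : Filter ℕ) ≤ atTop →
      Tendsto ν U (𝓝 μ) → ∀ (s : ℝ≥0) (y : ℝ), y ≠ 0 →
      ∫ p, semichar s y (embed p) ∂(μ : Measure (ℝ≥0 × ℝ)) = L s y :=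
    fun U μ hU hμ s y hy => integral_semichar_eq_of_tendsto hμ
      (fun y hy => (hL s y hy).mono_left hU) (hLr s) hy
  have hmem : ∀ᶠ n in atTop, ν n ∈ closure (range ν) :=
    Eventually.of_forall fun n => subset_closure (mem_range_self n)
  obtain ⟨μ, -, hμ⟩ := hcomp.exists_mapClusterPt_of_frequently hmem.frequently
  obtain ⟨U, hU, hUμ⟩ := mapClusterPt_iff_ultrafilter.1 hμ
  have hμL := hid U μ hU hUμ
  have hconv : Tendsto ν atTop (𝓝 μ) := by
    refine hcomp.tendsto_nhds_of_unique_mapClusterPt hmem fun μ' _ hμ' => ?_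
    obtain ⟨U', hU', hUμ'⟩ := mapClusterPt_iff_ultrafilter.1 hμ'
    refine Subtype.ext (ext_of_integral_semichar (μ := (μ' : Measure (ℝ≥0 × ℝ)))
      (ν := (μ : Measure (ℝ≥0 × ℝ))) fun s y hy => ?_)
    rw [hμL s y hy]
    exact hid U' μ' hU' hUμ' s y hy
  refine ⟨μ, hconv, ?_, hμL⟩
  have h1 := ProbabilityMeasure.tendsto_map_of_tendsto_of_continuous _ _ hconv continuous_fst
  exact congrArg (fun m : ProbabilityMeasure ℝ≥0 => (m : Measure ℝ≥0))
    (tendsto_nhds_unique h1 hfst)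

/-! ### The stable/Fréchet Lévy measure -/

theorem deficit_max_zero {γ s y : ℝ} (hy : 0 ≤ y) (x : ℝ) (u : ℝ≥0) :
    deficit γ s y (max x 0) u = deficit γ s y x u := by
  rcases le_or_gt x 0 with hx | hx
  · rw [max_eq_right hx, deficit_of_nonpos hy le_rfl, deficit_of_nonpos hy hx]
  · rw [max_eq_left hx.le]

theorem compProd_scaledKernel_posPart (γ : ℝ) (ω : Measure ℝ) [IsProbabilityMeasure ω]
    (ν : Measure ℝ≥0) [SFinite ν] :
    ν ⊗ₘ scaledKernel γ (posPart ω) =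
      (ν.prod ω).map fun p => (p.1, (p.1 : ℝ) ^ γ * max p.2 0) := by
  have h1 : ν.prod (posPart ω) = (ν.prod ω).map (Prod.map id fun x => max x 0) := by
    rw [← Measure.map_prod_map _ _ measurable_id (by fun_prop), Measure.map_id]
    rfl
  rw [compProd_scaledKernel, h1, Measure.map_map (by fun_prop) (by fun_prop)]
  rfl

theorem lintegral_levyForm (α β C K : ℝ) (ω : Measure ℝ) [IsProbabilityMeasure ω]
    {f : ℝ≥0 × EReal → ℝ≥0∞} (hf : Measurable f) :
    ∫⁻ p, f p ∂(levyForm α β C K (posPart ω)) =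
      ∫⁻ x, f (embed (0, x)) ∂(frechetLevy α C) +
      ∫⁻ x, ∫⁻ u, f (embed (u, (u : ℝ) ^ (β / α) * max x 0)) ∂(stableLevy β K) ∂ω := by
  have hg : Measurable fun p : ℝ≥0 × ℝ => (p.1, (p.1 : ℝ) ^ (β / α) * max p.2 0) := by fun_prop
  have hfe : Measurable fun p => f (embed p) := hf.comp measurable_embed
  -- the restriction in `levyForm` is harmless: `t > 0` and `x ≥ 0` almost everywhere
  have hrestr : (stableLevy β K ⊗ₘ scaledKernel (β / α) (posPart ω)).restrict
      (Ioi 0 ×ˢ Ici 0) = (((stableLevy β K).prod ω).map fun p =>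
        (p.1, (p.1 : ℝ) ^ (β / α) * max p.2 0)) := by
    rw [compProd_scaledKernel_posPart]
    refine Measure.restrict_eq_self_of_ae_mem ?_
    refine (ae_map_iff hg.aemeasurable (measurableSet_Ioi.prod measurableSet_Ici)).2 ?_
    have hne : ∀ᵐ u ∂(stableLevy β K), u ≠ 0 := by
      rw [ae_iff]; simp
    filter_upwards [Measure.quasiMeasurePreserving_fst.ae hne] with p hp
    exact ⟨pos_iff_ne_zero.2 hp, mul_nonneg (Real.rpow_nonneg p.1.2 _) (le_max_right _ _)⟩
  rw [levyForm, lintegral_map hf measurable_embed, lintegral_add_measure, Measure.dirac_prod,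
    lintegral_map hfe measurable_prodMk_left, hrestr, lintegral_map hfe hg]
  congr 1
  exact lintegral_prod_symm' _ (hfe.comp hg)

theorem levyForm_apply (α β C K : ℝ) (ω : Measure ℝ) [IsProbabilityMeasure ω]
    {S : Set (ℝ≥0 × EReal)} (hS : MeasurableSet S) :
    levyForm α β C K (posPart ω) S =
      frechetLevy α C {x | embed (0, x) ∈ S} +
      ∫⁻ x, stableLevy β K {u | embed (u, (u : ℝ) ^ (β / α) * max x 0) ∈ S} ∂ω := by
  rw [← lintegral_indicator_one hS, lintegral_levyForm _ _ _ _ _ (measurable_one.indicator hS)]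
  congr 1
  · exact lintegral_indicator_one (measurable_prodMk_left (measurable_embed hS))
  refine lintegral_congr fun x => ?_
  refine lintegral_indicator_one ?_
  · exact (measurable_embed.comp (by fun_prop : Measurable fun u : ℝ≥0 =>
      (u, (u : ℝ) ^ (β / α) * max x 0))) hS

theorem measurable_ofReal_one_sub_semichar (s : ℝ≥0) (y : EReal) :
    Measurable fun p => ENNReal.ofReal (1 - semichar s y p) :=
  (measurable_const.sub (measurable_semichar s y)).ennreal_ofReal

theorem jumpExponent_nonneg {α β K : ℝ} {ω : Measure ℝ} {s y : ℝ} (hs : 0 ≤ s) :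
    0 ≤ jumpExponent α β K ω s y :=
  integral_nonneg fun _ => integral_nonneg fun u => deficit_nonneg hs u

theorem integrable_integral_deficit {α β K : ℝ} (hα : 0 < α) (hβ : 0 < β) (hβ1 : β < 1)
    (hK : 0 < K) {ω : Measure ℝ} [IsProbabilityMeasure ω]
    (hω : Integrable (fun x : ℝ => max x 0 ^ α) ω) {s y : ℝ} (hs : 0 ≤ s) (hy : 0 < y) :
    Integrable (fun x => ∫ u, deficit (β / α) s y x u ∂(stableLevy β K)) ω := by
  refine Integrable.mono' (g := fun x => (∫ u : ℝ≥0, (1 - Real.exp (-(s * u))) ∂(stableLevy β K)) +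
    K * y ^ (-α) * max x 0 ^ α) ((integrable_const _).add (hω.const_mul _))
    (stronglyMeasurable_integral_deficit _ _ _ _).aestronglyMeasurable (ae_of_all _ fun x => ?_)
  refine abs_integral_deficit_le hα hβ (integrable_one_sub_exp_stableLevy hβ hβ1 hK) hs hy le_rfl
    (fun z hz => ?_) x
  rw [measureReal_def, stableLevy_Ioi hβ hK.le hz, ENNReal.toReal_ofReal (by positivity)]

theorem lintegral_one_sub_semichar_levyForm {α β C K : ℝ} (hα : 0 < α) (hβ : 0 < β)
    (hβ1 : β < 1) (hK : 0 < K) (hC : 0 ≤ C) {ω : Measure ℝ} [IsProbabilityMeasure ω]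
    (hω : Integrable (fun x : ℝ => max x 0 ^ α) ω) (s : ℝ≥0) {y : ℝ} (hy : 0 < y) :
    ∫⁻ p, ENNReal.ofReal (1 - semichar s y p) ∂(levyForm α β C K (posPart ω)) =
      ENNReal.ofReal (C * y ^ (-α) + jumpExponent α β K ω s y) := by
  rw [lintegral_levyForm _ _ _ _ _ (measurable_ofReal_one_sub_semichar s y),
    ENNReal.ofReal_add (by positivity) (jumpExponent_nonneg s.coe_nonneg)]
  congr 1
  · rw [← frechetLevy_Ioi hα hC hy, ← lintegral_indicator_one measurableSet_Ioi]
    refine lintegral_congr fun x => ?_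
    rw [semichar_embed]
    by_cases h : x ≤ y
    · rw [indicator_of_mem (by exact h), indicator_of_notMem (by simpa using h)]; simp
    · rw [indicator_of_notMem (by simpa using h), indicator_of_mem (by simpa using h)]; simp
  · rw [jumpExponent, ofReal_integral_eq_lintegral_ofReal
      (integrable_integral_deficit hα hβ hβ1 hK hω s.coe_nonneg hy)
      (ae_of_all _ fun x => integral_nonneg fun u => deficit_nonneg s.coe_nonneg u)]
    refine lintegral_congr fun x => ?_
    rw [ofReal_integral_eq_lintegral_ofReal (integrable_deficit
      (integrable_one_sub_exp_stableLevy hβ hβ1 hK) x (div_pos hβ hα) s.coe_nonneg hy)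
      (ae_of_all _ fun u => deficit_nonneg s.coe_nonneg u)]
    refine lintegral_congr fun u => ?_
    rw [semichar_embed_rpow, sub_sub_cancel, deficit_max_zero hy.le]

theorem lintegral_one_sub_semichar_top_levyForm {α β C K : ℝ} (hβ : 0 < β)
    (hβ1 : β < 1) (hK : 0 < K) {ω : Measure ℝ} [IsProbabilityMeasure ω] (s : ℝ≥0) :
    ∫⁻ p, ENNReal.ofReal (1 - semichar s ⊤ p) ∂(levyForm α β C K (posPart ω)) =
      ENNReal.ofReal (K * Real.Gamma (1 - β) * (s : ℝ) ^ β) := by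
  rw [lintegral_levyForm _ _ _ _ _ (measurable_ofReal_one_sub_semichar s ⊤)]
  simp only [semichar, Iic_top, indicator_univ, embed, NNReal.coe_zero, mul_zero, neg_zero,
    Real.exp_zero, sub_self, ENNReal.ofReal_zero, lintegral_zero, zero_add, lintegral_const,
    measure_univ, mul_one]
  exact lintegral_one_sub_exp_stableLevy hβ hβ1 hK s.coe_nonneg

theorem integrable_one_sub_semichar {η : Measure (ℝ≥0 × EReal)} {s : ℝ≥0} {y : EReal}
    (h : ∫⁻ p, ENNReal.ofReal (1 - semichar s y p) ∂η ≠ ∞) :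
    Integrable (fun p => 1 - semichar s y p) η := by
  refine ⟨(measurable_const.sub (measurable_semichar s y)).aestronglyMeasurable, ?_⟩
  rw [hasFiniteIntegral_iff_ofReal (ae_of_all _ fun p => sub_nonneg.2 (semichar_le_one s y p))]
  exact h.lt_top

theorem integral_one_sub_semichar_eq_toReal (η : Measure (ℝ≥0 × EReal)) (s : ℝ≥0) (y : EReal) :
    ∫ p, (1 - semichar s y p) ∂η =
      (∫⁻ p, ENNReal.ofReal (1 - semichar s y p) ∂η).toReal :=
  integral_eq_lintegral_of_nonneg_ae (ae_of_all _ fun p => sub_nonneg.2 (semichar_le_one s y p))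
    (measurable_const.sub (measurable_semichar s y)).aestronglyMeasurable

theorem tendsto_integral_one_sub_semichar_right {η : Measure (ℝ≥0 × EReal)} {s : ℝ≥0} {y : ℝ}
    (h : Integrable (fun p => 1 - semichar s y p) η) :
    Tendsto (fun y' : ℝ => ∫ p, (1 - semichar s y' p) ∂η) (𝓝[>] y)
      (𝓝 (∫ p, (1 - semichar s y p) ∂η)) := by
  refine tendsto_integral_filter_of_dominated_convergence (fun p => 1 - semichar s y p)
    (Eventually.of_forall fun y' =>
      (measurable_const.sub (measurable_semichar s y')).aestronglyMeasurable) ?_ h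
    (ae_of_all _ fun p => ?_)
  · filter_upwards [self_mem_nhdsWithin] with y' (hy' : y < y')
    refine ae_of_all _ fun p => ?_
    rw [Real.norm_eq_abs, abs_of_nonneg (sub_nonneg.2 (semichar_le_one s y' p))]
    refine sub_le_sub_left (indicator_le_indicator_of_subset (Iic_subset_Iic.2 ?_)
      (fun _ => (Real.exp_pos _).le) _) _
    exact EReal.coe_le_coe_iff.2 hy'.le
  · refine tendsto_nhds_of_eventually_eq ?_
    rcases le_or_gt p.2 y with h | h
    · filter_upwards [self_mem_nhdsWithin] with y' (hy' : y < y')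
      rw [semichar, semichar,
        indicator_of_mem (by exact h.trans (EReal.coe_le_coe_iff.2 hy'.le)),
        indicator_of_mem (by exact h)]
    · filter_upwards [nhdsWithin_le_nhds
        (continuous_coe_real_ereal.continuousAt.eventually (gt_mem_nhds h))] with y' hy'
      rw [semichar, semichar, indicator_of_notMem (by simpa using hy'),
        indicator_of_notMem (by simpa using h)]

theorem min_one_le_two_mul_one_sub_exp {t : ℝ} (ht : 0 ≤ t) :
    min 1 t ≤ 2 * (1 - Real.exp (-t)) := by
  have h1 : Real.exp (-t) ≤ 1 / (1 + t) := by
    rw [Real.exp_neg, ← one_div]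
    exact one_div_le_one_div_of_le (by linarith) (by linarith [Real.add_one_le_exp t])
  have h2 : min 1 t ≤ 2 * (1 - 1 / (1 + t)) := by
    have h3 : 1 - 1 / (1 + t) = t / (1 + t) := by field_simp; ring
    rw [h3, mul_div_assoc', le_div_iff₀ (by linarith)]
    rcases le_total 1 t with h | h
    · rw [min_eq_left h]; linarith
    · rw [min_eq_right h]; nlinarith
  linarith

theorem isLevyMeasure_levyForm {α β C K : ℝ} (hα : 0 < α) (hβ : 0 < β)
    (hβ1 : β < 1) (hK : 0 < K) (hC : 0 ≤ C) {ω : Measure ℝ} [IsProbabilityMeasure ω]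
    (hω : Integrable (fun x : ℝ => max x 0 ^ α) ω) :
    IsLevyMeasure 0 (levyForm α β C K (posPart ω)) where
  supported := by
    rw [levyForm_apply _ _ _ _ _ (MeasurableSet.univ.prod measurableSet_Iio)]
    have h1 : {x : ℝ | embed (0, x) ∈ (univ : Set ℝ≥0) ×ˢ Iio (0 : EReal)} ⊆ Iic 0 := by
      intro x hx
      have : (x : EReal) < 0 := hx.2
      exact (EReal.coe_neg'.1 this).le
    have h2 : ∀ x : ℝ, {u : ℝ≥0 | embed (u, (u : ℝ) ^ (β / α) * max x 0) ∈
        (univ : Set ℝ≥0) ×ˢ Iio (0 : EReal)} = ∅ := by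
      intro x
      refine eq_empty_of_forall_notMem fun u hu => ?_
      have h3 : (((u : ℝ) ^ (β / α) * max x 0 : ℝ) : EReal) < 0 := hu.2
      exact absurd (EReal.coe_neg'.1 h3)
        (not_lt.2 (mul_nonneg (Real.rpow_nonneg u.2 _) (le_max_right _ _)))
    simp only [h2, measure_empty, lintegral_zero, add_zero]
    exact measure_mono_null h1 (frechetLevy_Iic_zero α C)
  origin := by
    rw [levyForm_apply _ _ _ _ _ (measurableSet_singleton _)]
    have h1 : {x : ℝ | embed (0, x) ∈ ({(0, 0)} : Set (ℝ≥0 × EReal))} ⊆ Iic 0 := by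
      intro x hx
      have : (x : EReal) = 0 := congrArg Prod.snd hx
      exact (EReal.coe_eq_zero.1 this).le
    have h2 : ∀ x : ℝ, stableLevy β K {u : ℝ≥0 | embed (u, (u : ℝ) ^ (β / α) * max x 0) ∈
        ({(0, 0)} : Set (ℝ≥0 × EReal))} = 0 := fun x =>
      measure_mono_null (fun u hu => congrArg Prod.fst hu) (stableLevy_zero β K)
    simp only [h2, lintegral_zero, add_zero]
    exact measure_mono_null h1 (frechetLevy_Iic_zero α C)
  small_jumps := by
    have h1 : ∀ p : ℝ≥0 × EReal, ((min 1 p.1 : ℝ≥0) : ℝ≥0∞) ≤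
        2 * ENNReal.ofReal (1 - semichar 1 ⊤ p) := by
      intro p
      have h2 : semichar 1 ⊤ p = Real.exp (-(p.1 : ℝ)) := by simp [semichar]
      rw [h2, ← ENNReal.ofReal_ofNat, ← ENNReal.ofReal_mul (by norm_num),
        ← ENNReal.ofReal_coe_nnreal]
      refine ENNReal.ofReal_le_ofReal ?_
      push_cast
      exact min_one_le_two_mul_one_sub_exp p.1.2
    refine (lintegral_mono h1).trans_lt ?_
    rw [lintegral_const_mul _ (measurable_ofReal_one_sub_semichar 1 ⊤),
      lintegral_one_sub_semichar_top_levyForm hβ hβ1 hK]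
    exact ENNReal.mul_lt_top (by simp) ENNReal.ofReal_lt_top
  tail y hy := by
    induction y with
    | bot => simp at hy
    | top => simp
    | coe y =>
      have hy' : 0 < y := EReal.coe_pos.1 hy
      rw [← lintegral_indicator_one (MeasurableSet.univ.prod measurableSet_Ioi)]
      refine (lintegral_mono fun p => ?_).trans_lt
        ((lintegral_one_sub_semichar_levyForm hα hβ hβ1 hK hC hω 0 hy').trans_lt
          ENNReal.ofReal_lt_top)
      by_cases h : p.2 ≤ y
      · rw [indicator_of_notMem (by simpa using h)]
        exact zero_le
      · rw [indicator_of_mem (by simpa using h), semichar, indicator_of_notMem (by simpa using h)]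
        simp

/-- At `s = 0` the exponent is the tail of a Fréchet law. -/
theorem jumpExponent_zero {α β K : ℝ} (hα : 0 < α) (hβ : 0 < β) (hK : 0 < K)
    {ω : Measure ℝ} {y : ℝ} (hy : 0 < y) :
    jumpExponent α β K ω 0 y = K * (∫ x, max x 0 ^ α ∂ω) * y ^ (-α) := by
  have h1 : ∀ x, ∫ u, deficit (β / α) 0 y x u ∂(stableLevy β K) =
      K * y ^ (-α) * max x 0 ^ α := by
    intro x
    rcases le_or_gt x 0 with hx | hx
    · simp only [deficit_of_nonpos hy.le hx]
      rw [max_eq_right hx, Real.zero_rpow hα.ne']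
      simp
    · have hz := threshold_pos (γ := β / α) hy hx
      simp only [deficit_of_pos (div_pos hβ hα) hy hx, zero_mul, neg_zero, Real.exp_zero, sub_self,
        zero_add]
      rw [integral_indicator_const _ measurableSet_Ioi, measureReal_def,
        stableLevy_Ioi hβ hK.le hz, ENNReal.toReal_ofReal (by positivity),
        threshold_rpow_neg hα hβ hy hx, max_eq_left hx.le, smul_eq_mul]
      ring
  simp only [jumpExponent, h1]
  rw [integral_const_mul]
  ring

/-! ### The Lévy representation of the limit law -/

theorem clTransform_zero (m : Measure (ℝ≥0 × EReal)) (y : EReal) :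
    clTransform m 0 y = (cdfSnd m y).toReal := by
  have hS : MeasurableSet ((univ : Set ℝ≥0) ×ˢ Iic y) := MeasurableSet.univ.prod measurableSet_Iic
  rw [cdfSnd, ← measureReal_def, ← integral_indicator_one hS]
  refine integral_congr_ae (ae_of_all _ fun p => ?_)
  by_cases h : p.2 ≤ y
  · rw [semichar, indicator_of_mem (by exact h), indicator_of_mem (by simpa using h)]; simp
  · rw [semichar, indicator_of_notMem (by simpa using h), indicator_of_notMem (by simpa using h)]

theorem cdfSnd_mono (m : Measure (ℝ≥0 × EReal)) : Monotone (cdfSnd m) := fun _ _ h =>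
  measure_mono (prod_mono_right (Iic_subset_Iic.2 h))

theorem clTransform_nonneg (m : Measure (ℝ≥0 × EReal)) (s : ℝ≥0) (y : EReal) :
    0 ≤ clTransform m s y := integral_nonneg fun p => semichar_nonneg s y p

theorem semichar_le_semichar_zero (s : ℝ≥0) (y : EReal) (p : ℝ≥0 × EReal) :
    semichar s y p ≤ semichar 0 y p := by
  refine indicator_le_indicator ?_
  simpa using exp_neg_mul_le_one s.coe_nonneg p.1

theorem clTransform_eq_zero {m : Measure (ℝ≥0 × EReal)} [IsFiniteMeasure m] {y : EReal}
    (h : cdfSnd m y = 0) (s : ℝ≥0) : clTransform m s y = 0 := by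
  refine le_antisymm ?_ (clTransform_nonneg m s y)
  have h1 : clTransform m s y ≤ clTransform m 0 y := integral_mono (integrable_semichar s y m)
    (integrable_semichar 0 y m) (semichar_le_semichar_zero s y)
  rwa [clTransform_zero, h, ENNReal.toReal_zero] at h1

theorem ae_snd_le_zero {m : Measure (ℝ≥0 × EReal)}
    (h : ∀ y : ℝ, 0 < y → ∀ᵐ p ∂m, p.2 ≤ (y : EReal)) : ∀ᵐ p ∂m, p.2 ≤ 0 := by
  have h1 : ∀ n : ℕ, ∀ᵐ p ∂m, p.2 ≤ ((1 / ((n : ℝ) + 1) : ℝ) : EReal) := fun n =>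
    h (1 / ((n : ℝ) + 1)) (by positivity)
  filter_upwards [ae_all_iff.2 h1] with p hp
  refine ge_of_tendsto' (x := atTop) (f := fun n : ℕ => ((1 / ((n : ℝ) + 1) : ℝ) : EReal)) ?_ hp
  exact (continuous_coe_real_ereal.tendsto 0).comp tendsto_one_div_add_atTop_nhds_zero_nat

/-- The Lévy representation of a law on `ℝ₊ × ℝ` follows from its C-L transform at the levels
`y > 0`, the absence of mass on negative levels and the Laplace transform of the first marginal.
At `y = 0` the formula is nontrivial only if there is no mass above `0` at all. -/
theorem hasLevyRepresentation_of_formula {α β C K : ℝ} (hα : 0 < α) (hβ : 0 < β)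
    (hβ1 : β < 1) (hK : 0 < K) (hC : 0 ≤ C) {ω : Measure ℝ} [IsProbabilityMeasure ω]
    (hω : Integrable (fun x : ℝ => max x 0 ^ α) ω) {μ : Measure (ℝ≥0 × ℝ)}
    [IsProbabilityMeasure μ]
    (hpos : ∀ (s : ℝ≥0) (y : ℝ), 0 < y → ∫ p, semichar s y (embed p) ∂μ =
      Real.exp (-(C * y ^ (-α) + jumpExponent α β K ω s y)))
    (hneg : ∀ y : ℝ, y < 0 → ∫ p, semichar 0 y (embed p) ∂μ = 0)
    (htop : ∀ s : ℝ≥0, ∫ u : ℝ≥0, Real.exp (-((s : ℝ) * u)) ∂μ.fst =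
      Real.exp (-(K * Real.Gamma (1 - β) * (s : ℝ) ^ β))) :
    HasLevyRepresentation (μ.map embed) 0 0 (levyForm α β C K (posPart ω)) := by
  set η := levyForm α β C K (posPart ω)
  set m := μ.map embed with hm
  have : IsProbabilityMeasure m := Measure.isProbabilityMeasure_map measurable_embed.aemeasurable
  have hlint : ∀ (s : ℝ≥0) {y : ℝ}, 0 < y →
      ∫⁻ p, ENNReal.ofReal (1 - semichar s y p) ∂η =
      ENNReal.ofReal (C * y ^ (-α) + jumpExponent α β K ω s y) := fun s y hy =>
    lintegral_one_sub_semichar_levyForm hα hβ hβ1 hK hC hω s hy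
  have hcdf_neg : ∀ y : EReal, y < 0 → cdfSnd m y = 0 := by
    intro y hy
    obtain ⟨r, hyr, hr0⟩ := EReal.lt_iff_exists_real_btwn.1 hy
    have h1 := hneg r (EReal.coe_neg'.1 hr0)
    rw [← clTransform_map_embed, clTransform_zero, ENNReal.toReal_eq_zero_iff] at h1
    have h2 := h1.resolve_right (measure_ne_top _ _)
    exact le_antisymm ((cdfSnd_mono m hyr.le).trans_eq h2) zero_le
  have hcdf_pos : ∀ y : EReal, 0 < y → 0 < cdfSnd m y := by
    intro y hy
    obtain ⟨r, hr0, hry⟩ := EReal.lt_iff_exists_real_btwn.1 hy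
    refine lt_of_lt_of_le (pos_iff_ne_zero.2 fun h0 => ?_) (cdfSnd_mono m hry.le)
    have h1 := hpos 0 r (EReal.coe_pos.1 hr0)
    rw [← clTransform_map_embed, clTransform_zero, ← hm, h0, ENNReal.toReal_zero] at h1
    exact (Real.exp_pos _).ne h1
  have hform : ∀ (s : ℝ≥0) (y : ℝ), 0 < y →
      Integrable (fun p => 1 - semichar s y p) η ∧
      clTransform m s y = Real.exp (-∫ p, (1 - semichar s y p) ∂η) := by
    intro s y hy
    refine ⟨integrable_one_sub_semichar (by rw [hlint s hy]; exact ENNReal.ofReal_ne_top), ?_⟩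
    rw [clTransform_map_embed, hpos s y hy, integral_one_sub_semichar_eq_toReal, hlint s hy,
      ENNReal.toReal_ofReal (add_nonneg (by positivity) (jumpExponent_nonneg s.coe_nonneg))]
  refine ⟨?_, isLevyMeasure_levyForm hα hβ hβ1 hK hC hω, fun s y hy => ?_, fun s y hy => ?_⟩
  · refine le_antisymm (le_of_forall_gt_imp_ge_of_dense fun y hy => sInf_le (hcdf_pos y hy))
      (le_sInf fun y hy => ?_)
    by_contra hlt
    exact (ne_of_gt hy) (hcdf_neg y (not_le.1 hlt))
  · rw [NNReal.coe_zero, zero_mul, zero_add]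
    rcases hy with hy | ⟨rfl, hy⟩
    · induction y with
      | bot => simp at hy
      | top =>
        have h1 := lintegral_one_sub_semichar_top_levyForm (α := α) (C := C) hβ hβ1 hK (ω := ω) s
        have hGpos : 0 < Real.Gamma (1 - β) := Real.Gamma_pos_of_pos (by linarith)
        refine ⟨integrable_one_sub_semichar (by rw [h1]; exact ENNReal.ofReal_ne_top), ?_⟩
        rw [integral_one_sub_semichar_eq_toReal, h1, ENNReal.toReal_ofReal (by positivity),
          clTransform_map_embed, ← htop s, Measure.fst, integral_map (by fun_prop) (by fun_prop)]
        simp [semichar, embed]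
      | coe y => exact hform s y (EReal.coe_pos.1 hy)
    · -- an atom at `0` forces the Fréchet part to vanish, so that `A = 0` almost surely and
      -- the levels `0` and `1` are equivalent
      set c := C + K * ∫ x, max x 0 ^ α ∂ω with hc
      have hI : 0 ≤ ∫ x, max x 0 ^ α ∂ω :=
        integral_nonneg fun x => Real.rpow_nonneg (le_max_right _ _) _
      have hc0 : 0 ≤ c := add_nonneg hC (mul_nonneg hK.le hI)
      have hlevel : ∀ y : ℝ, 0 < y →
          C * y ^ (-α) + jumpExponent α β K ω 0 y = c * y ^ (-α) := fun y hy => by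
        rw [jumpExponent_zero hα hβ hK hy, hc]; ring
      have hc_zero : c = 0 := by
        by_contra hne
        have hcpos : 0 < c := lt_of_le_of_ne hc0 (Ne.symm hne)
        have h1 : ∀ y : ℝ, 0 < y → (cdfSnd m 0).toReal ≤ Real.exp (-(c * y ^ (-α))) := by
          intro y hy
          have h2 := hpos 0 y hy
          rw [NNReal.coe_zero, hlevel y hy, ← clTransform_map_embed, clTransform_zero] at h2
          rw [← h2]
          exact ENNReal.toReal_mono (measure_ne_top _ _)
            (cdfSnd_mono m (EReal.coe_nonneg.2 hy.le))
        have h2 : Tendsto (fun y : ℝ => Real.exp (-(c * y ^ (-α)))) (𝓝[>] 0) (𝓝 0) := by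
          have h3 : Tendsto (fun y : ℝ => y ^ (-α)) (𝓝[>] 0) atTop :=
            tendsto_rpow_neg_nhdsGT_zero (neg_neg_of_pos hα)
          exact Real.tendsto_exp_neg_atTop_nhds_zero.comp (h3.const_mul_atTop hcpos)
        have h3 : (cdfSnd m 0).toReal ≤ 0 := ge_of_tendsto h2 (by
          filter_upwards [self_mem_nhdsWithin] with y hy using h1 y hy)
        exact (ENNReal.toReal_pos hy.ne' (measure_ne_top _ _)).not_ge h3
      have hη : ∀ᵐ p ∂η, p.2 ≤ 0 := ae_snd_le_zero fun y hy => by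
        have h2 := hlint 0 hy
        rw [NNReal.coe_zero, hlevel y hy, hc_zero, zero_mul, ENNReal.ofReal_zero,
          lintegral_eq_zero_iff (measurable_ofReal_one_sub_semichar _ _)] at h2
        filter_upwards [h2] with p hp
        by_contra hlt
        rw [semichar, indicator_of_notMem (by simpa using hlt)] at hp
        simp at hp
      have hμ : ∀ᵐ p ∂m, p.2 ≤ 0 := ae_snd_le_zero fun y hy => by
        have h2 := hpos 0 y hy
        rw [NNReal.coe_zero, hlevel y hy, hc_zero, zero_mul, neg_zero,
          Real.exp_zero, ← clTransform_map_embed, clTransform_zero] at h2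
        have h3 : m (univ ×ˢ Iic (y : EReal)) = 1 := by
          rwa [cdfSnd, ENNReal.toReal_eq_one_iff] at h2
        have h4 : ∀ᵐ p ∂m, p ∈ (univ : Set ℝ≥0) ×ˢ Iic (y : EReal) :=
          (mem_ae_iff_prob_eq_one (MeasurableSet.univ.prod measurableSet_Iic)).2 h3
        filter_upwards [h4] with p hp using hp.2
      have hsemi : ∀ p : ℝ≥0 × EReal, p.2 ≤ 0 →
          semichar s 0 p = semichar s (1 : ℝ) p := fun p hp => by
        rw [semichar, semichar, indicator_of_mem (by exact hp), indicator_of_mem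
          (by exact hp.trans (EReal.coe_nonneg.2 zero_le_one))]
      have h1 : (fun p => 1 - semichar s (1 : ℝ) p) =ᵐ[η] fun p => 1 - semichar s 0 p := by
        filter_upwards [hη] with p hp
        rw [hsemi p hp]
      obtain ⟨hi, he⟩ := hform s 1 one_pos
      refine ⟨hi.congr h1, ?_⟩
      rw [← integral_congr_ae h1, ← he]
      refine integral_congr_ae ?_
      filter_upwards [hμ] with p hp using hsemi p hp
  · refine clTransform_eq_zero ?_ s
    push Not at hy
    rcases lt_trichotomy y 0 with h | h | h
    · exact hcdf_neg y h
    · rw [h]; exact le_antisymm (hy.2 h) zero_le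
    · exact absurd h (not_lt.2 hy.1)

/-! ### Existence of the limit law -/

theorem integral_one_sub_semichar_levyForm {α β C K : ℝ} (hα : 0 < α) (hβ : 0 < β)
    (hβ1 : β < 1) (hK : 0 < K) (hC : 0 ≤ C) {ω : Measure ℝ} [IsProbabilityMeasure ω]
    (hω : Integrable (fun x : ℝ => max x 0 ^ α) ω) (s : ℝ≥0) {y : ℝ} (hy : 0 < y) :
    ∫ p, (1 - semichar s y p) ∂(levyForm α β C K (posPart ω)) =
      C * y ^ (-α) + jumpExponent α β K ω s y := by
  rw [integral_one_sub_semichar_eq_toReal,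
    lintegral_one_sub_semichar_levyForm hα hβ hβ1 hK hC hω s hy,
    ENNReal.toReal_ofReal (add_nonneg (by positivity) (jumpExponent_nonneg s.coe_nonneg))]

theorem measurable_normalizedPair {Ω : Type*} [MeasurableSpace Ω] (α β : ℝ)
    {W : ℕ → Ω → ℝ≥0} {J : ℕ → Ω → ℝ} (hW : ∀ i, Measurable (W i)) (hJ : ∀ i, Measurable (J i))
    (n : ℕ) : Measurable (normalizedPair α β W J n) := by
  have h1 : Measurable (partialSum W n) := Finset.measurable_sum _ fun i _ => hW i
  have h2 : Measurable (partialMax J n) := Measurable.iSup fun i => hJ i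
  exact (h1.const_mul _).prodMk (h2.const_mul _)

/-- The limit of the C-L transforms of the normalized pairs. -/
noncomputable def limitTransform (α β C K : ℝ) (ω : Measure ℝ) (s y : ℝ) : ℝ :=
  if 0 < y then Real.exp (-(C * y ^ (-α) + jumpExponent α β K ω s y)) else 0

theorem tendsto_limitTransform_right {α β C K : ℝ} (hα : 0 < α) (hβ : 0 < β)
    (hβ1 : β < 1) (hK : 0 < K) (hC : 0 ≤ C) {ω : Measure ℝ} [IsProbabilityMeasure ω]
    (hω : Integrable (fun x : ℝ => max x 0 ^ α) ω) (s : ℝ≥0) {y : ℝ} (hy : y ≠ 0) :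
    Tendsto (limitTransform α β C K ω s) (𝓝[>] y) (𝓝 (limitTransform α β C K ω s y)) := by
  rcases lt_or_gt_of_ne hy with hy | hy
  · refine tendsto_nhds_of_eventually_eq ?_
    filter_upwards [nhdsWithin_le_nhds (gt_mem_nhds hy)] with y' hy'
    rw [limitTransform, limitTransform, if_neg hy.le.not_gt, if_neg hy'.le.not_gt]
  · rw [limitTransform, if_pos hy,
      ← integral_one_sub_semichar_levyForm hα hβ hβ1 hK hC hω s hy]
    have hint : Integrable (fun p => 1 - semichar s y p) (levyForm α β C K (posPart ω)) :=
      integrable_one_sub_semichar (by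
        rw [lintegral_one_sub_semichar_levyForm hα hβ hβ1 hK hC hω s hy]
        exact ENNReal.ofReal_ne_top)
    refine ((Real.continuous_exp.tendsto _).comp
      (tendsto_integral_one_sub_semichar_right hint).neg).congr' ?_
    filter_upwards [self_mem_nhdsWithin] with y' (hy' : y < y')
    rw [limitTransform, if_pos (hy.trans hy'), Function.comp_apply,
      integral_one_sub_semichar_levyForm hα hβ hβ1 hK hC hω s (hy.trans hy')]

theorem limitTransform_zero {α β C K : ℝ} (hα : 0 < α) (hβ : 0 < β) (hK : 0 < K)
    {ω : Measure ℝ} {y : ℝ} (hy : 0 < y) : limitTransform α β C K ω 0 y =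
      Real.exp (-((C + K * ∫ x, max x 0 ^ α ∂ω) * y ^ (-α))) := by
  rw [limitTransform, if_pos hy, jumpExponent_zero hα hβ hK hy, add_mul]

/-- Joint convergence of normalized sums and maxima. The variables `J i` dominate the jumps
`Jbar i`, and on semicharacters they differ from them by the factor of an independent Fréchet
variable (`C = 0` meaning that there is none). -/
theorem exists_limit_law {Ω Ω' : Type*} [MeasurableSpace Ω] [MeasurableSpace Ω']
    {P : Measure Ω} [IsProbabilityMeasure P] {P' : Measure Ω'} [IsProbabilityMeasure P']
    {α β C K : ℝ} (hα : 0 < α) (hβ : 0 < β) (hβ1 : β < 1) (hK : 0 < K) (hC : 0 ≤ C)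
    {D : Ω' → ℝ≥0} (hDm : Measurable D)
    (hD : ∀ s : ℝ, 0 ≤ s →
      ∫ x, Real.exp (-(s * (D x : ℝ))) ∂P' = Real.exp (-(K * Real.Gamma (1 - β) * s ^ β)))
    {ω : Measure ℝ} [IsProbabilityMeasure ω] (hωpos : 0 < ω (Ici 0))
    (hω : Integrable (fun x : ℝ => max x 0 ^ α) ω)
    {W : ℕ → Ω → ℝ≥0} {Jbar : Ω → ℝ} {J : ℕ → Ω → ℝ}
    (hWm : ∀ i, Measurable (W i)) (hJbarm : Measurable Jbar) (hJm : ∀ i, Measurable (J i))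
    (hW : StrictDONA β W P D P') (hWJ : IsIID (fun i x => (W i x, J i x)) P)
    (hlaw : P.map (fun a => (W 0 a, Jbar a)) =
      ((P.map (W 0)).prod ω).map fun p => (p.1, (p.1 : ℝ) ^ (β / α) * p.2))
    (hle : ∀ x, Jbar x ≤ J 0 x)
    (hfactor : ∀ (n : ℕ), 0 < n → ∀ (s : ℝ≥0) (y : ℝ), 0 < y →
      ∫ a, semichar s y (embed ((n : ℝ≥0) ^ (-(1 / β)) * W 0 a,
        (n : ℝ) ^ (-(1 / α)) * J 0 a)) ∂P =
      Real.exp (-(C * y ^ (-α) / n)) *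
        ∫ a, semichar s y (embed ((n : ℝ≥0) ^ (-(1 / β)) * W 0 a,
          (n : ℝ) ^ (-(1 / α)) * Jbar a)) ∂P) :
    ∃ μ : ProbabilityMeasure (ℝ≥0 × ℝ),
      (μ : Measure (ℝ≥0 × ℝ)).fst = P'.map D ∧
      TendstoInDistribution (normalizedPair α β W J) atTop id (fun _ => P)
        (μ : Measure (ℝ≥0 × ℝ)) ∧
      HasLevyRepresentation ((μ : Measure (ℝ≥0 × ℝ)).map embed) 0 0
        (levyForm α β C K (posPart ω)) ∧
      ∀ y : ℝ, 0 < y → (μ : Measure (ℝ≥0 × ℝ)).snd (Iic y) =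
        ENNReal.ofReal (Real.exp (-((C + K * ∫ x, max x 0 ^ α ∂ω) * y ^ (-α)))) := by
  have hm := measurable_normalizedPair α β hWm hJm
  have hatt := hW.laplaceAttracted hDm hD hWm
  have hQ := Measure.isProbabilityMeasure_map (μ := P) (hWm 0).aemeasurable
  set ν : ℕ → ProbabilityMeasure (ℝ≥0 × ℝ) := fun n =>
    ⟨P.map (normalizedPair α β W J n), Measure.isProbabilityMeasure_map (hm n).aemeasurable⟩
    with hν
  have hνint : ∀ (n : ℕ) (s : ℝ≥0) (y : ℝ),
      ∫ p, semichar s y (embed p) ∂(ν n : Measure (ℝ≥0 × ℝ)) =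
      ∫ x, semichar s y (embed (normalizedPair α β W J n x)) ∂P := fun n s y =>
    integral_map (hm n).aemeasurable (measurable_semichar_embed s y).aestronglyMeasurable
  have hfst : Tendsto (fun n => (ν n).map measurable_fst.aemeasurable) atTop
      (𝓝 (⟨P'.map D, Measure.isProbabilityMeasure_map hDm.aemeasurable⟩ :
        ProbabilityMeasure ℝ≥0)) := by
    refine hW.2.tendsto.congr fun n => Subtype.ext ?_
    exact (Measure.map_map measurable_fst (hm n)).symm
  have hpos_lim : ∀ (s : ℝ≥0) (y : ℝ), 0 < y →
      Tendsto (fun n => ∫ p, semichar s y (embed p) ∂(ν n : Measure (ℝ≥0 × ℝ))) atTop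
        (𝓝 (limitTransform α β C K ω s y)) := by
    intro s y hy
    have h1 := tendsto_integral_semichar_pow (hWm 0) hJbarm hα hβ hβ1 hK hω hlaw hatt s hy
    rw [limitTransform, if_pos hy, neg_add, Real.exp_add]
    refine (h1.const_mul (Real.exp (-(C * y ^ (-α))))).congr' ?_
    filter_upwards [eventually_gt_atTop 0] with n hn
    have hn' : (n : ℝ) ≠ 0 := by positivity
    rw [hνint, integral_semichar_normalizedPair hWm hJm hWJ α β hn, hfactor n hn s y hy, mul_pow,
      ← Real.exp_nat_mul]
    congr 2
    field_simp
  -- on negative levels all `n` variables have to be negative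
  have hneg_lim : ∀ (s : ℝ≥0) (y : ℝ), y < 0 →
      Tendsto (fun n => ∫ p, semichar s y (embed p) ∂(ν n : Measure (ℝ≥0 × ℝ))) atTop (𝓝 0) := by
    intro s y hy
    set q := P.real {a | J 0 a < 0} with hq
    have hq1 : q < 1 := by
      have h1 : 0 < P {a | 0 ≤ J 0 a} := by
        have h2 : P.map (fun a => (W 0 a, Jbar a)) (univ ×ˢ Ici 0) ≥ ω (Ici 0) := by
          rw [hlaw, Measure.map_apply (by fun_prop) (MeasurableSet.univ.prod measurableSet_Ici)]
          have h3 : ω (Ici 0) = ((P.map (W 0)).prod ω) (univ ×ˢ Ici 0) := by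
            rw [Measure.prod_prod, measure_univ, one_mul]
          rw [ge_iff_le, h3]
          exact measure_mono fun p hp =>
            ⟨mem_univ _, mul_nonneg (Real.rpow_nonneg p.1.2 _) hp.2⟩
        rw [Measure.map_apply ((hWm 0).prodMk hJbarm)
          (MeasurableSet.univ.prod measurableSet_Ici)] at h2
        refine hωpos.trans_le (h2.trans (measure_mono fun a ha => ?_))
        exact le_trans ha.2 (hle a)
      have h2 : {a | J 0 a < 0} = {a | 0 ≤ J 0 a}ᶜ := by ext; simp
      have h3 : MeasurableSet {a | 0 ≤ J 0 a} := measurableSet_le measurable_const (hJm 0)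
      rw [hq, h2, probReal_compl_eq_one_sub h3]
      have h4 : 0 < P.real {a | 0 ≤ J 0 a} := ENNReal.toReal_pos h1.ne' (measure_ne_top _ _)
      linarith
    refine squeeze_zero' (Eventually.of_forall fun n => integral_nonneg fun p =>
      semichar_nonneg s y _) ?_ (tendsto_pow_atTop_nhds_zero_of_lt_one measureReal_nonneg hq1)
    filter_upwards [eventually_gt_atTop 0] with n hn
    rw [hνint, integral_semichar_normalizedPair hWm hJm hWJ α β hn]
    refine pow_le_pow_left₀ (integral_nonneg fun a => semichar_nonneg s y _) ?_ n
    have hS : MeasurableSet {a | J 0 a < 0} := measurableSet_lt (hJm 0) measurable_const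
    have hmeas : Measurable fun a => semichar s y (embed ((n : ℝ≥0) ^ (-(1 / β)) * W 0 a,
        (n : ℝ) ^ (-(1 / α)) * J 0 a)) := (measurable_semichar_embed s y).comp
      (((hWm 0).const_mul _).prodMk ((hJm 0).const_mul _))
    rw [← integral_indicator_one hS]
    refine integral_mono (Integrable.of_bound hmeas.aestronglyMeasurable 1 (ae_of_all _ fun a => by
        rw [Real.norm_eq_abs, abs_of_nonneg (semichar_nonneg s y _)]
        exact semichar_le_one s y _)) ((integrable_const (1 : ℝ)).indicator hS) fun a => ?_
    have hpow : 0 < (n : ℝ) ^ (-(1 / α)) := by positivity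
    by_cases h : J 0 a < 0
    · rw [indicator_of_mem (by exact h)]
      exact semichar_le_one s y _
    · have := mul_nonneg hpow.le (not_lt.1 h)
      simp only [semichar_embed]
      rw [indicator_of_notMem (by simp only [mem_Iic, not_le]; linarith),
        indicator_of_notMem (by exact h)]
  have hL : ∀ (s : ℝ≥0) (y : ℝ), y ≠ 0 →
      Tendsto (fun n => ∫ p, semichar s y (embed p) ∂(ν n : Measure (ℝ≥0 × ℝ))) atTop
        (𝓝 (limitTransform α β C K ω s y)) := by
    intro s y hy
    rcases lt_or_gt_of_ne hy with hy | hy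
    · rw [limitTransform, if_neg hy.le.not_gt]
      exact hneg_lim s y hy
    · exact hpos_lim s y hy
  have hL1 : Tendsto (limitTransform α β C K ω (0 : ℝ≥0)) atTop (𝓝 1) := by
    have h1 : Tendsto (fun y : ℝ => Real.exp (-((C + K * ∫ x, max x 0 ^ α ∂ω) * y ^ (-α)))) atTop
        (𝓝 1) := by
      have := ((tendsto_rpow_neg_atTop hα).const_mul (C + K * ∫ x, max x 0 ^ α ∂ω)).neg
      rw [mul_zero, neg_zero] at this
      simpa [Function.comp_def] using (Real.continuous_exp.tendsto 0).comp this
    refine h1.congr' ?_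
    filter_upwards [eventually_gt_atTop 0] with y hy
    rw [NNReal.coe_zero, limitTransform_zero hα hβ hK hy]
  obtain ⟨μ, hμ, hμfst, hμL⟩ := exists_tendsto_of_tendsto_semichar hfst
    (L := fun s y => limitTransform α β C K ω s y) hL
    (fun s y hy => tendsto_limitTransform_right hα hβ hβ1 hK hC hω s hy) hL1
    (fun y hy => by rw [limitTransform, if_neg hy.le.not_gt])
  have hμfst' : (μ : Measure (ℝ≥0 × ℝ)).fst = P'.map D := hμfst
  refine ⟨μ, hμfst', ⟨fun n => (hm n).aemeasurable, aemeasurable_id, ?_⟩, ?_, fun y hy => ?_⟩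
  · have hid : (⟨(μ : Measure (ℝ≥0 × ℝ)).map id,
        Measure.isProbabilityMeasure_map aemeasurable_id⟩ : ProbabilityMeasure (ℝ≥0 × ℝ)) = μ :=
      Subtype.ext Measure.map_id
    rw [hid]
    exact hμ
  · refine hasLevyRepresentation_of_formula hα hβ hβ1 hK hC hω (fun s y hy => ?_)
      (fun y hy => ?_) fun s => ?_
    · rw [hμL s y hy.ne', limitTransform, if_pos hy]
    · rw [hμL 0 y hy.ne, limitTransform, if_neg hy.le.not_gt]
    · rw [hμfst', integral_map hDm.aemeasurable (by fun_prop)]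
      exact hD s s.coe_nonneg
  · have h1 := hμL 0 y hy.ne'
    rw [integral_semichar_zero, NNReal.coe_zero, limitTransform_zero hα hβ hK hy] at h1
    rw [← h1, ofReal_measureReal]

/-- Taking the maximum with an independent Fréchet variable multiplies the expectation of a
normalized semicharacter by `exp (-C y^{-α} / n)`. -/
theorem integral_semichar_max_eq {Ω : Type*} [MeasurableSpace Ω] {P : Measure Ω}
    [IsProbabilityMeasure P] {W : Ω → ℝ≥0} {J J' : Ω → ℝ} (hW : Measurable W)
    (hJ : Measurable J) (hJ' : Measurable J') (hind : IndepFun (fun x => (W x, J x)) J' P)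
    {α C : ℝ} (hα : 0 < α)
    (hJ'law : ∀ x : ℝ, 0 < x → P {p | J' p ≤ x} = ENNReal.ofReal (Real.exp (-(C * x ^ (-α)))))
    {n : ℕ} (hn : 0 < n) (b s : ℝ≥0) {y : ℝ} (hy : 0 < y) :
    ∫ a, semichar s y (embed (b * W a, (n : ℝ) ^ (-(1 / α)) * max (J' a) (J a))) ∂P =
      Real.exp (-(C * y ^ (-α) / n)) *
        ∫ a, semichar s y (embed (b * W a, (n : ℝ) ^ (-(1 / α)) * J a)) ∂P := by
  have hn' : (0 : ℝ) < n := by exact_mod_cast hn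
  have hpow : 0 < (n : ℝ) ^ (-(1 / α)) := by positivity
  set z := (n : ℝ) ^ (1 / α) * y with hz
  have hz0 : 0 < z := by positivity
  have hle : ∀ x : ℝ, (n : ℝ) ^ (-(1 / α)) * x ≤ y ↔ x ≤ z := fun x => by
    rw [hz, Real.rpow_neg hn'.le, inv_mul_le_iff₀ (by positivity)]
  set f : ℝ≥0 × ℝ → ℝ := fun p => semichar s y (embed (b * p.1, (n : ℝ) ^ (-(1 / α)) * p.2))
    with hf
  have hfm : Measurable f := (measurable_semichar_embed s y).comp
    ((measurable_fst.const_mul _).prodMk (measurable_snd.const_mul _))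
  set g : ℝ → ℝ := (Iic z).indicator 1
  have hgm : Measurable g := measurable_one.indicator measurableSet_Iic
  have hprod : ∀ a, semichar s y (embed (b * W a, (n : ℝ) ^ (-(1 / α)) * max (J' a) (J a))) =
      g (J' a) * f (W a, J a) := by
    intro a
    simp only [hf, g, semichar_embed, indicator_apply, mem_Iic, hle, max_le_iff]
    by_cases h1 : J' a ≤ z <;> by_cases h2 : J a ≤ z <;> simp [h1, h2]
  have hg : ∫ a, g (J' a) ∂P = Real.exp (-(C * y ^ (-α) / n)) := by
    have h1 : (fun a => g (J' a)) = {a | J' a ≤ z}.indicator 1 := rfl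
    rw [h1, integral_indicator_one (measurableSet_le hJ' measurable_const), measureReal_def,
      hJ'law z hz0, ENNReal.toReal_ofReal (Real.exp_pos _).le, hz,
      Real.mul_rpow (by positivity) hy.le, ← Real.rpow_mul hn'.le,
      show 1 / α * -α = -1 by field_simp, Real.rpow_neg_one]
    congr 2
    field_simp
  have hindep : IndepFun (fun a => g (J' a)) (fun a => f (W a, J a)) P :=
    hind.symm.comp hgm hfm
  simp only [hprod]
  rw [hindep.integral_fun_mul_eq_mul_integral (hgm.comp hJ').aestronglyMeasurable
    (hfm.comp (hW.prodMk hJ)).aestronglyMeasurable, hg]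

theorem integral_max_zero_rpow_pos {α : ℝ} {ω : Measure ℝ}
    (hω : Integrable (fun x : ℝ => max x 0 ^ α) ω) (h : 0 < ω (Ioi 0)) :
    0 < ∫ x, max x 0 ^ α ∂ω := by
  rw [integral_pos_iff_support_of_nonneg
    (fun x => Real.rpow_nonneg (le_max_right _ _) _) hω]
  refine h.trans_le (measure_mono fun x (hx : 0 < x) => ?_)
  rw [Function.mem_support, max_eq_left hx.le]
  exact (Real.rpow_pos_of_pos hx α).ne'

end SumMax

theorem mainTheorem8 {Ω Ω' : Type*} [MeasurableSpace Ω] [MeasurableSpace Ω']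
    (P : MeasureTheory.Measure Ω) [MeasureTheory.IsProbabilityMeasure P]
    (P' : MeasureTheory.Measure Ω') [MeasureTheory.IsProbabilityMeasure P']
    (α β K : ℝ) (hα : 0 < α) (hβ : 0 < β) (hβ1 : β < 1) (hK : 0 < K)
    -- the strictly `β`-stable variable `D`, given by its Laplace transform
    (D : Ω' → ℝ≥0) (hDmeas : Measurable D)
    (hD : ∀ s : ℝ, 0 ≤ s →
      ∫ x, Real.exp (-(s * (D x : ℝ))) ∂P' = Real.exp (-(K * Real.Gamma (1 - β) * s ^ β)))
    -- the measure `ω`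
    (ω : MeasureTheory.Measure ℝ) [MeasureTheory.IsProbabilityMeasure ω]
    (hωpos : 0 < ω (Set.Ici 0))
    (hωint : MeasureTheory.IntegrableOn (fun x : ℝ => x ^ α) (Set.Ici 0) ω)
    -- the i.i.d. sequence `(W i, Jbar i)`
    (W : ℕ → Ω → ℝ≥0) (Jbar : ℕ → Ω → ℝ)
    (hWmeas : ∀ i, Measurable (W i)) (hJmeas : ∀ i, Measurable (Jbar i))
    (hW : SumMax.StrictDONA β W P D P')
    (hWJ : SumMax.IsIID (fun i x => (W i x, Jbar i x)) P)
    (hcond : ∀ i, ∀ᵐ t ∂(P.map (W i)),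
      ProbabilityTheory.condDistrib (Jbar i) (W i) P t
        = ω.map (fun x : ℝ => (t : ℝ) ^ (β / α) * x)) :
    (∃ μ : MeasureTheory.ProbabilityMeasure (ℝ≥0 × ℝ),
      (μ : MeasureTheory.Measure (ℝ≥0 × ℝ)).fst = P'.map D ∧
      MeasureTheory.TendstoInDistribution (SumMax.normalizedPair α β W Jbar)
        Filter.atTop id (fun _ => P) (μ : MeasureTheory.Measure (ℝ≥0 × ℝ)) ∧
      SumMax.HasLevyRepresentation ((μ : MeasureTheory.Measure (ℝ≥0 × ℝ)).map SumMax.embed) 0 0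
        (SumMax.levyForm α β 0 K (SumMax.posPart ω)) ∧
      (0 < ω (Set.Ioi 0) → SumMax.SndIsFrechet α (μ : MeasureTheory.Measure (ℝ≥0 × ℝ)))) ∧
    (∀ (C : ℝ) (_ : 0 < C) (Jtilde : ℕ → Ω → ℝ) (_ : ∀ i, Measurable (Jtilde i))
      (_ : SumMax.IsIID (fun i x => ((W i x, Jbar i x), Jtilde i x)) P)
      (_ : ∀ i, ProbabilityTheory.IndepFun (fun x => (W i x, Jbar i x)) (Jtilde i) P)
      (_ : ∀ i, ∀ x : ℝ, 0 < x →
        P {p | Jtilde i p ≤ x} = ENNReal.ofReal (Real.exp (-(C * x ^ (-α))))),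
      ∃ μ : MeasureTheory.ProbabilityMeasure (ℝ≥0 × ℝ),
        (μ : MeasureTheory.Measure (ℝ≥0 × ℝ)).fst = P'.map D ∧
        MeasureTheory.TendstoInDistribution
          (SumMax.normalizedPair α β W (fun i x => max (Jtilde i x) (Jbar i x)))
          Filter.atTop id (fun _ => P) (μ : MeasureTheory.Measure (ℝ≥0 × ℝ)) ∧
        SumMax.HasLevyRepresentation ((μ : MeasureTheory.Measure (ℝ≥0 × ℝ)).map SumMax.embed) 0 0
          (SumMax.levyForm α β C K (SumMax.posPart ω)) ∧
        SumMax.SndIsFrechet α (μ : MeasureTheory.Measure (ℝ≥0 × ℝ))) := by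
  have hω := SumMax.integrable_max_zero_rpow hα hωint
  have hlaw := SumMax.map_pair_eq_of_condDistrib (hWmeas 0) (hJmeas 0) (hcond 0)
  refine ⟨?_, fun C hC Jtilde hJtm hiid hind hJtlaw => ?_⟩
  · obtain ⟨μ, h1, h2, h3, h4⟩ := SumMax.exists_limit_law hα hβ hβ1 hK le_rfl hDmeas hD hωpos hω
      hWmeas (hJmeas 0) hJmeas hW hWJ hlaw (fun _ => le_rfl) (fun n _ s y _ => by simp)
    refine ⟨μ, h1, h2, h3, fun hpos => ⟨_, ?_, h4⟩⟩
    rw [zero_add]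
    exact mul_pos hK (SumMax.integral_max_zero_rpow_pos hω hpos)
  · have hmaxm : ∀ i, Measurable fun x => max (Jtilde i x) (Jbar i x) := fun i =>
      (hJtm i).max (hJmeas i)
    have hg : Measurable fun p : (ℝ≥0 × ℝ) × ℝ => (p.1.1, max p.2 p.1.2) := by fun_prop
    have hiid' : SumMax.IsIID (fun i x => (W i x, max (Jtilde i x) (Jbar i x))) P :=
      ⟨hiid.1.comp (fun _ => fun p : (ℝ≥0 × ℝ) × ℝ => (p.1.1, max p.2 p.1.2)) fun _ => hg,
        fun i => (hiid.2 i).comp hg⟩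
    obtain ⟨μ, h1, h2, h3, h4⟩ := SumMax.exists_limit_law hα hβ hβ1 hK hC.le hDmeas hD hωpos hω
      hWmeas (hJmeas 0) hmaxm hW hiid' hlaw (fun _ => le_max_right _ _) (fun n hn s y hy =>
        SumMax.integral_semichar_max_eq (hWmeas 0) (hJmeas 0) (hJtm 0) (hind 0) hα (hJtlaw 0) hn
          _ s hy)
    refine ⟨μ, h1, h2, h3, _, ?_, h4⟩
    exact add_pos_of_pos_of_nonneg hC (mul_nonneg hK.le
      (MeasureTheory.integral_nonneg fun x => Real.rpow_nonneg (le_max_right _ _) _))
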